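/- **Setting.** Let $F_2=\langle a,b\rangle$ be the free group on two generators, whose elements are identified with reduced words over $L_2=\{a,b,a^{-1},b^{-1}\}$, and let $|w|$ be the length of $w$. A word $w$ is *minimal* if $|\phi(w)|\ge |w|$ for all $\phi\in\operatorname{Aut}F_2$. An *automorphic conjugacy class* is an orbit $W$ of $\operatorname{Aut}F_2$ on $F_2$. Let $C_2$ be the set of reduced words $x_1\cdots x_n$ with $x_n\ne x_1^{-1}$ (including the empty word). For nonempty $u\in C_2$ and $w\in C_2$, let $(u)_w$ be the number of occurrences of the subwords $u$ and $u^{-1}$ in $w$ regarded as a cyclic word, with $(u)_w=0$ if $|u|>|w|$. A word $w\in C_2$ is a *root word* if $|(ab)_w-(ab^{-1})_w|=(aa)_w=(bb)_w$, and is *alternating* if $(aa)_w=0=(bb)_w$. A *root class* is an automorphic conjugacy class that contains a root word. Let $J\le\operatorname{Aut}F_2$ be generated by the inner automorphisms and the automorphisms permuting $L_2$; write $w\sim_J v$ if $\phi(w)=v$ for some $\phi\in J$, and let $[w]$ be the class of $w$ under $\sim_J$. A *one-letter automorphism* is an automorphism of the form $x\mapsto x$, $y\mapsto yx$, where $x,y\in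 L_2$ and $y\notin\{x,x^{-1}\}$. The directed multigraph $\Gamma(W)$ has as vertices the $\sim_J$-classes of minimal words in $W$, and the number of edges from $[w]$ to $[v]$ is the number of classes modulo $\operatorname{Inn}F_2$ of one-letter automorphisms $\phi$ (a class counting once if it contains such a $\phi$) with $\phi(w)\in[v]$; this does not depend on the representatives. **Theorem.** Let $W$ be a root class that contains an alternating minimal word, and assume that the minimal words of $W$ do not have length $1$ (that is, $a\notin W$). Then exactly one vertex $[w_0]$ of $\Gamma(W)$ contains an alternating minimal word, and $\Gamma(W)$ is one of the following directed multigraphs, up to an isomorphism that sends $[w_0]$ to the vertex indicated. - (R4) A single vertex $[w_0]$ with four loops. - (R5) Two vertices $[w_0]$ and $u$, with two loops at $[w_0]$, two edges from $[w_0]$ to $u$ and two edges from $u$ to $[w_0]$. - (R6) Three vertices $[w_0]$, $u$, $v$, with two edges from $[w_0]$ to each of $u$ and $v$, one edge from each of $u$ and $v$ to $[w_0]$, one edge from $u$ to $v$ and one edge from $v$ to $u$. - (R7) The bow tie centred at $[w_0]$: five vertices $[w_0],u_1,u_2,u_3,u_4$, with exactly one edge in each direction between $[w_0]$ and each $u_i$,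 between $u_1$ and $u_2$, and between $u_3$ and $u_4$. There are no edges other than those listed. Moreover, for every root class $W$ (with or without an alternating minimal word), the number of vertices of $\Gamma(W)$ is $1$, $2$, $3$ or $5$. -/

import Mathlib

/-- The free group `F₂` on two generators. Its elements are identified with reduced words through
`FreeGroup.toWord`, and `FreeGroup.norm` is the length of the reduced word. -/
abbrev F2 : Type := FreeGroup (Fin 2)

namespace F2

/-- The generator `a`. -/
def a : F2 := FreeGroup.of 0

/-- The generator `b`. -/
def b : F2 := FreeGroup.of 1

/-- The alphabet `L₂ = {a, b, a⁻¹, b⁻¹}`. -/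
def letters : Set F2 := {a, b, a⁻¹, b⁻¹}

/-- `w` is minimal: no automorphism of `F₂` decreases its length. -/
def IsMinimal (w : F2) : Prop := ∀ φ : MulAut F2, w.norm ≤ (φ w).norm

/-- Automorphic conjugacy classes: the orbits of `Aut F₂` on `F₂`. -/
def IsAutClass (W : Set F2) : Prop := ∃ w : F2, W = {v | ∃ φ : MulAut F2, φ w = v}

/-- Membership in `C₂`: the reduced word `x₁ ⋯ xₙ` of `w` satisfies `xₙ ≠ x₁⁻¹`. -/
def IsCyclic (w : F2) : Prop := FreeGroup.IsCyclicallyReduced w.toWord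

/-- The number `(u)_w` of occurrences of the subwords `u` and `u⁻¹` in the cyclic word `w`, counted
by their starting position `i`: an occurrence at `i` is a prefix of the `i`-th rotation of `w`.
It is `0` when `u` is longer than `w`. -/
def subwordCount (u w : F2) : ℕ :=
  ((Finset.range w.toWord.length).filter fun i =>
    u.toWord <+: w.toWord.rotate i ∨ (u⁻¹).toWord <+: w.toWord.rotate i).card

/-- Root words: elements `w` of `C₂` with `|(ab)_w - (ab⁻¹)_w| = (aa)_w = (bb)_w`. -/
def IsRootWord (w : F2) : Prop :=
  IsCyclic w ∧
    |(subwordCount (a * b) w : ℤ) - (subwordCount (a * b⁻¹) w : ℤ)| = (subwordCount (a * a) w : ℤ) ∧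
    subwordCount (a * a) w = subwordCount (b * b) w

/-- Alternating words: elements `w` of `C₂` with `(aa)_w = 0 = (bb)_w`. -/
def IsAlternating (w : F2) : Prop :=
  IsCyclic w ∧ subwordCount (a * a) w = 0 ∧ subwordCount (b * b) w = 0

/-- A root class is an automorphic conjugacy class that contains a root word. -/
def IsRootClass (W : Set F2) : Prop := IsAutClass W ∧ ∃ w ∈ W, IsRootWord w

/-- The permutations (type I automorphisms): automorphisms that permute `L₂`. -/
def IsPermutation (φ : MulAut F2) : Prop := φ '' letters = letters

/-- The one-letter automorphisms `({y}, x)`, for letters `x` and `y ∉ {x, x⁻¹}`: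
the automorphism that maps `x` to `x` and `y` to `yx`. -/
def IsOneLetter (φ : MulAut F2) : Prop :=
  ∃ x ∈ letters, ∃ y ∈ letters, y ≠ x ∧ y ≠ x⁻¹ ∧ φ x = x ∧ φ y = y * x

/-- The subgroup `Inn F₂` of inner automorphisms. -/
def Inn : Subgroup (MulAut F2) := (MulAut.conj : F2 →* MulAut F2).range

/-- The subgroup `J` of `Aut F₂` generated by the inner automorphisms and the permutations. -/
def J : Subgroup (MulAut F2) := Subgroup.closure ({φ | φ ∈ Inn} ∪ {φ | IsPermutation φ})

/-- The relation `w ∼_J v`. -/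
def JEquiv (w v : F2) : Prop := ∃ φ ∈ J, φ w = v

theorem JEquiv.refl (w : F2) : JEquiv w w := ⟨1, J.one_mem, rfl⟩

theorem JEquiv.symm {w v : F2} (h : JEquiv w v) : JEquiv v w := by
  obtain ⟨φ, hφ, rfl⟩ := h
  exact ⟨φ⁻¹, J.inv_mem hφ, by simp⟩

theorem JEquiv.trans {u v w : F2} (h : JEquiv u v) (h' : JEquiv v w) : JEquiv u w := by
  obtain ⟨φ, hφ, rfl⟩ := h
  obtain ⟨ψ, hψ, rfl⟩ := h'
  exact ⟨ψ * φ, J.mul_mem hψ hφ, rfl⟩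

/-- The minimal words in `W`. -/
def MinimalWord (W : Set F2) : Type := {w : F2 // w ∈ W ∧ IsMinimal w}

/-- `∼_J` as an equivalence relation on the minimal words in `W`. -/
def jSetoid (W : Set F2) : Setoid (MinimalWord W) where
  r w v := JEquiv w.1 v.1
  iseqv := ⟨fun w => JEquiv.refl w.1, JEquiv.symm, JEquiv.trans⟩

/-- The vertices of `Γ(W)`: the classes of minimal words in `W` under `∼_J`. -/
def Vertex (W : Set F2) : Type := Quotient (jSetoid W)

/-- The classes `[φ]` modulo `Inn F₂` of the one-letter automorphisms `φ` with `φ(w) ∈ [v]`. -/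
def edgeClasses (w v : F2) : Set (MulAut F2 ⧸ Inn) :=
  {q | ∃ φ : MulAut F2, IsOneLetter φ ∧ (φ : MulAut F2 ⧸ Inn) = q ∧ JEquiv (φ w) v}

/-- The number of edges from `[w]` to `[v]`. -/
noncomputable def edgeCount (w v : F2) : ℕ := (edgeClasses w v).ncard

instance Inn.normal : Inn.Normal := by
  refine ⟨?_⟩
  rintro _ ⟨g, rfl⟩ φ
  exact ⟨φ g, by ext x; simp [MulAut.conj_apply]⟩

theorem IsPermutation.apply_mem {π : MulAut F2} (h : IsPermutation π) {x : F2}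
    (hx : x ∈ letters) : π x ∈ letters := h ▸ Set.mem_image_of_mem π hx

theorem IsPermutation.inv {π : MulAut F2} (h : IsPermutation π) : IsPermutation π⁻¹ := by
  unfold IsPermutation at h ⊢
  conv_lhs => rw [← h]
  rw [← Set.image_comp]
  convert Set.image_id _
  ext x
  simp

theorem IsOneLetter.conj {φ π : MulAut F2} (hφ : IsOneLetter φ) (hπ : IsPermutation π) :
    IsOneLetter (π * φ * π⁻¹) := by
  obtain ⟨x, hx, y, hy, h1, h2, h3, h4⟩ := hφ
  refine ⟨π x, hπ.apply_mem hx, π y, hπ.apply_mem hy, ?_, ?_, ?_, ?_⟩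
  · exact fun h => h1 (π.injective h)
  · exact fun h => h2 (π.injective (by simpa using h))
  · simp [MulAut.mul_apply, h3]
  · simp [MulAut.mul_apply, h4]

theorem edgeClasses_subset_of_permutation {π : MulAut F2} (hπ : IsPermutation π) (w v : F2) :
    (fun q : MulAut F2 ⧸ Inn => (π : MulAut F2 ⧸ Inn) * q * (π : MulAut F2 ⧸ Inn)⁻¹) ''
      edgeClasses w v ⊆ edgeClasses (π w) v := by
  rintro _ ⟨_, ⟨φ, hφ, rfl, h⟩, rfl⟩
  refine ⟨π * φ * π⁻¹, hφ.conj hπ, rfl, ?_⟩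
  have : (π * φ * π⁻¹) (π w) = π (φ w) := by simp [MulAut.mul_apply]
  rw [this]
  exact JEquiv.trans (JEquiv.symm ⟨π, Subgroup.subset_closure (Or.inr hπ), rfl⟩) h

theorem edgeCount_permutation {π : MulAut F2} (hπ : IsPermutation π) (w v : F2) :
    edgeCount (π w) v = edgeCount w v := by
  unfold edgeCount
  rw [← Set.ncard_image_of_injective (edgeClasses w v)
    (f := fun q => (π : MulAut F2 ⧸ Inn) * q * (π : MulAut F2 ⧸ Inn)⁻¹)
    (fun p q h => by simpa using h)]
  congr 1
  refine Set.Subset.antisymm (fun q hq => ?_) (edgeClasses_subset_of_permutation hπ w v)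
  have h := edgeClasses_subset_of_permutation hπ.inv (π w) v ⟨q, hq, rfl⟩
  rw [show π⁻¹ (π w) = w by simp] at h
  refine ⟨_, h, ?_⟩
  simp [mul_assoc]

theorem edgeCount_inner {ψ : MulAut F2} (hψ : ψ ∈ Inn) (w v : F2) :
    edgeCount (ψ w) v = edgeCount w v := by
  have key : ∀ φ : MulAut F2, JEquiv (φ (ψ w)) (φ w) := fun φ => by
    refine JEquiv.symm ⟨φ * ψ * φ⁻¹,
      Subgroup.subset_closure (Or.inl (Inn.normal.conj_mem ψ hψ φ)), ?_⟩
    simp [MulAut.mul_apply]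
  unfold edgeCount
  congr 1
  ext q
  exact ⟨fun ⟨φ, h1, h2, h3⟩ => ⟨φ, h1, h2, (key φ).symm.trans h3⟩,
    fun ⟨φ, h1, h2, h3⟩ => ⟨φ, h1, h2, (key φ).trans h3⟩⟩

theorem edgeCount_of_mem_J {ψ : MulAut F2} (hψ : ψ ∈ J) :
    ∀ w v : F2, edgeCount (ψ w) v = edgeCount w v := by
  induction hψ using Subgroup.closure_induction with
  | mem x hx => exact hx.elim (fun h => edgeCount_inner h) (fun h => edgeCount_permutation h)
  | one => exact fun _ _ => rfl
  | mul x y _ _ h1 h2 =>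
    intro w v
    rw [MulAut.mul_apply, h1, h2]
  | inv x _ h =>
    intro w v
    rw [← h (x⁻¹ w) v]
    simp

theorem edgeCount_congr {w w' v v' : F2} (hw : JEquiv w w') (hv : JEquiv v v') :
    edgeCount w v = edgeCount w' v' := by
  obtain ⟨ψ, hψ, rfl⟩ := hw
  rw [edgeCount_of_mem_J hψ]
  unfold edgeCount
  congr 1
  ext q
  exact ⟨fun ⟨φ, h1, h2, h3⟩ => ⟨φ, h1, h2, h3.trans hv⟩,
    fun ⟨φ, h1, h2, h3⟩ => ⟨φ, h1, h2, h3.trans hv.symm⟩⟩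

/-- A directed multigraph on `V`, loops allowed, given by its numbers of edges. -/
structure MultiDigraph (V : Type) where
  /-- The number of edges from one vertex to another. -/
  edges : V → V → ℕ

/-- The directed multigraph `Γ(W)`. -/
noncomputable def Gamma (W : Set F2) : MultiDigraph (Vertex W) where
  edges := Quotient.lift₂ (fun w v : MinimalWord W => edgeCount w.1 v.1)
    (fun _ _ _ _ hw hv => edgeCount_congr hw hv)

/-- The vertex `v` of `Γ(W)` contains an alternating (minimal) word. -/
def Vertex.HasAlternating {W : Set F2} (v : Vertex W) : Prop :=
  ∃ w : MinimalWord W, IsAlternating w.1 ∧ (Quotient.mk (jSetoid W) w : Vertex W) = v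

/-- There is an isomorphism of directed multigraphs from `G` to `H` that maps `v` to `u`. -/
def MultiDigraph.PointedIso {V U : Type} (G : MultiDigraph V) (v : V) (H : MultiDigraph U)
    (u : U) : Prop :=
  ∃ e : V ≃ U, e v = u ∧ ∀ x y : V, G.edges x y = H.edges (e x) (e y)

/-- The directed multigraph on `{0, …, n - 1}` whose numbers of edges are the entries of `M`. -/
def ofMatrix {n : ℕ} (M : Matrix (Fin n) (Fin n) ℕ) : MultiDigraph (Fin n) := ⟨M⟩

/-- One vertex with four loops. -/
def graphR4 : MultiDigraph (Fin 1) := ofMatrix !![4]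

/-- The centre `0` has two loops, and two edges run each way between `0` and `1`. -/
def graphR5 : MultiDigraph (Fin 2) := ofMatrix
  !![2, 2;
     2, 0]

/-- Two edges run from the centre `0` to each of `1`, `2`, one edge from each of these to `0`,
and one edge each way between `1` and `2`. -/
def graphR6 : MultiDigraph (Fin 3) := ofMatrix
  !![0, 2, 2;
     1, 0, 1;
     1, 1, 0]

/-- The bow tie with centre `0`: the triangles `{0, 1, 2}` and `{0, 3, 4}`, with one edge each way
along each side. -/
def graphR7 : MultiDigraph (Fin 5) := ofMatrix
  !![0, 1, 1, 1, 1;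
     1, 0, 1, 0, 0;
     1, 1, 0, 0, 0;
     1, 0, 0, 0, 1;
     1, 0, 0, 1, 0]

end F2

/-
The one-letter automorphism `b ↦ ba` changes the length of the cyclic word of `g` by
`(bb)_g + ((ab)_g - (ab⁻¹)_g)`; the other one-letter automorphisms change it by an expression of
the same shape, with `aa` in place of `bb` or with the opposite sign. Hence both positive
automorphisms `b ↦ ba` and `a ↦ ab` fail to shorten `g` iff `(aa)_g + t` and `(bb)_g + t` are
nonnegative, where `t = (ab)_g - (ab⁻¹)_g`, and these inequalities persist when either of them is
applied. By Nielsen's theorem, modulo inner automorphisms every automorphism is a product `j χ j'`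
with `j`, `j'` permuting the letters and `χ` a product of `b ↦ ba` and `a ↦ ab`. So a word that no
one-letter automorphism shortens is minimal, and the minimal words of an orbit are connected by
length-preserving one-letter automorphisms: a finite list of classes closed under these is all of
`Γ(W)`.

For an alternating minimal word `w` we have `aa = bb = t = 0`, so all four one-letter automorphisms
preserve its length. Relations such as `τ'⁻¹ τ = π τ'` modulo inner automorphisms, where `τ` is
`b ↦ ba`, `τ'` is `a ↦ ab` and `π` permutes the letters, join the images in two pairs, and whatever
remains either returns to `w` or lengthens. An image of `w` which is again alternating is conjugate
to `w`; an image which is not alternating is not equivalent to the other image in its pair. The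
identifications that remain give (R4)-(R7). A root word that is not alternating has
`aa = bb = |t| > 0`; it has at most two neighbours, and either one of them is alternating and
minimal or these three words are all the vertices.
-/

/-! ### Cyclic words -/

namespace CyclicWord

open FreeGroup

variable {α : Type*}

theorem isCyclicallyReduced_iff_append_self {L : List (α × Bool)} :
    IsCyclicallyReduced L ↔ IsReduced (L ++ L) := by
  rw [isCyclicallyReduced_iff, FreeGroup.IsReduced, FreeGroup.IsReduced, List.isChain_append]
  tauto

theorem isReduced_append_iff {L M : List (α × Bool)} :
    IsReduced (L ++ M) ↔
      IsReduced L ∧ IsReduced M ∧ ∀ x ∈ L.getLast?, (x.1, !x.2) ∉ M.head? := by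
  rw [FreeGroup.IsReduced, List.isChain_append]
  refine and_congr_right fun _ => and_congr_right fun _ => forall₂_congr fun x _ => ?_
  refine ⟨fun h hx => by simpa using h _ hx rfl, fun h y hy hxy => ?_⟩
  by_contra hne
  exact h (by rwa [show (x.1, !x.2) = y from Prod.ext hxy (Bool.not_eq.2 hne)])

theorem isCyclicallyReduced_concat {x : α × Bool} {L : List (α × Bool)}
    (h : IsCyclicallyReduced (x :: L)) : IsCyclicallyReduced (L ++ [x]) := by
  rw [isCyclicallyReduced_iff_append_self] at h ⊢
  have htail : IsReduced (L ++ x :: L) := h.infix ⟨[x], [], by simp⟩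
  have hinit : IsReduced (x :: L ++ [x]) := h.infix ⟨[], L, by simp⟩
  have hall : L ++ [x] ++ (L ++ [x]) = L ++ (x :: L ++ [x]) := by simp
  rw [hall]
  exact isReduced_append_iff.2
    ⟨htail.infix ⟨[], x :: L, rfl⟩, hinit, (isReduced_append_iff.1 htail).2.2⟩

theorem isCyclicallyReduced_rotate {L : List (α × Bool)} (h : IsCyclicallyReduced L) (n : ℕ) :
    IsCyclicallyReduced (L.rotate n) := by
  induction n generalizing L with
  | zero => simpa using h
  | succ n ih =>
    cases L with
    | nil => simp
    | cons x L =>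
      rw [List.rotate_cons_succ]
      exact ih (isCyclicallyReduced_concat h)

theorem isConj_mk_of_isRotated {L M : List (α × Bool)} (h : L ~r M) : IsConj (mk L) (mk M) := by
  obtain ⟨n, hn, rfl⟩ := List.isRotated_iff_mod.1 h
  rw [List.rotate_eq_drop_append_take hn, ← mul_mk]
  nth_rw 1 [← List.take_append_drop n L]
  rw [← mul_mk]
  exact isConj_iff.2 ⟨(mk (L.take n))⁻¹, by group⟩

theorem mk_eq_mk_iff_of_isReduced {L M : List (α × Bool)} (hL : IsReduced L)
    (hM : IsReduced M) : mk L = mk M ↔ L = M := by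
  classical
  refine ⟨fun h => ?_, fun h => h ▸ rfl⟩
  rw [← hL.reduce_eq, ← hM.reduce_eq]
  exact reduce.sound h

theorem isReduced_invRev {L : List (α × Bool)} (hL : IsReduced L) : IsReduced (invRev L) := by
  classical
  rw [isReduced_iff_reduce_eq, reduce_invRev, hL.reduce_eq]

theorem isReduced_conj {G L : List (α × Bool)} (hG : IsReduced G) (hL : IsReduced L)
    (hne : L ≠ []) (hhead : ∀ x ∈ G.getLast?, (x.1, !x.2) ∉ L.head?)
    (hlast : ∀ x ∈ G.getLast?, x ∉ L.getLast?) : IsReduced (G ++ L ++ invRev G) := by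
  refine isReduced_append_iff.2
    ⟨isReduced_append_iff.2 ⟨hG, hL, hhead⟩, isReduced_invRev hG, fun y hy hy' => ?_⟩
  rw [List.getLast?_append_of_ne_nil _ hne] at hy
  simp only [invRev, List.head?_reverse, List.getLast?_map, Option.mem_def,
    Option.map_eq_some_iff, Prod.mk.injEq, Bool.not_inj_iff] at hy'
  obtain ⟨x, hx, hxy⟩ := hy'
  exact hlast x hx (by rwa [Prod.ext hxy.1 hxy.2])

theorem toWord_mk_of_isReduced [DecidableEq α] {L : List (α × Bool)} (hL : IsReduced L) :
    (mk L).toWord = L := by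
  rw [toWord_mk, hL.reduce_eq]

theorem reduceCyclically_eq_self [DecidableEq α] {L : List (α × Bool)}
    (h : IsCyclicallyReduced L) : reduceCyclically L = L := by
  induction L using List.bidirectionalRec with
  | nil => simp
  | singleton x => simp
  | cons_append x l y _ =>
    rw [reduceCyclically.cons_append, if_neg]
    · rfl
    · rintro ⟨h1, h2⟩
      rw [(isCyclicallyReduced_cons_append_iff.1 h).2 h1] at h2
      exact Bool.not_ne_self _ h2

theorem reduceCyclically_conj [DecidableEq α] (G : List (α × Bool)) {L : List (α × Bool)}
    (hL : IsCyclicallyReduced L) : reduceCyclically (G ++ L ++ invRev G) = L := by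
  induction G with
  | nil => simpa using reduceCyclically_eq_self hL
  | cons x G ih =>
    have hcons : x :: G ++ L ++ invRev (x :: G) = x :: (G ++ L ++ invRev G ++ [(x.1, !x.2)]) := by
      simp [invRev]
    rw [hcons, reduceCyclically.cons_append, if_pos (by simp), ih]

theorem isRotated_of_conj_mk {G L M : List (α × Bool)} (hG : IsReduced G)
    (hL : IsCyclicallyReduced L) (hM : IsCyclicallyReduced M)
    (h : mk G * mk L * (mk G)⁻¹ = mk M) : L ~r M := by
  classical
  induction G using List.reverseRecOn generalizing L with
  | nil =>
    rw [← one_eq_mk, one_mul, inv_one, mul_one,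
      mk_eq_mk_iff_of_isReduced hL.isReduced hM.isReduced] at h
    rw [h]
  | append_singleton G x ih =>
    have hGred : IsReduced G := hG.infix ⟨[], [x], by simp⟩
    have hinv : (mk [x])⁻¹ = mk [(x.1, !x.2)] := rfl
    rcases eq_or_ne L [] with rfl | hne
    · rw [← one_eq_mk, mul_one, mul_inv_cancel, one_eq_mk,
        mk_eq_mk_iff_of_isReduced IsReduced.nil hM.isReduced] at h
      rw [h]
    by_cases hhead : (x.1, !x.2) ∈ L.head?
    · obtain ⟨L, rfl⟩ := List.head?_eq_some_iff.1 hhead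
      refine List.IsRotated.trans ⟨1, by simp⟩ (ih hGred (isCyclicallyReduced_concat hL) ?_)
      rw [← h, ← mul_mk, ← mul_mk, ← List.singleton_append (l := L), ← mul_mk (L₁ := [_]), ← hinv]
      group
    by_cases hlast : x ∈ L.getLast?
    · obtain ⟨L, rfl⟩ := List.getLast?_eq_some_iff.1 hlast
      have hrot : (L ++ [x]).rotate L.length = [x] ++ L := List.rotate_append_length_eq L [x]
      have hcyc := isCyclicallyReduced_rotate hL L.length
      rw [hrot] at hcyc
      refine List.IsRotated.trans ⟨L.length, hrot⟩ (ih hGred hcyc ?_)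
      rw [← h, ← mul_mk, ← mul_mk, ← mul_mk]
      group
    have hred : IsReduced (G ++ [x] ++ L ++ invRev (G ++ [x])) :=
      isReduced_conj hG hL.isReduced hne (by simpa using hhead) (by simpa using hlast)
    rw [inv_mk, mul_mk, mul_mk, mk_eq_mk_iff_of_isReduced hred hM.isReduced] at h
    rw [← reduceCyclically_conj (G ++ [x]) hL, h, reduceCyclically_eq_self hM]

theorem isRotated_of_isConj {L M : List (α × Bool)} (hL : IsCyclicallyReduced L)
    (hM : IsCyclicallyReduced M) (h : IsConj (mk L) (mk M)) : L ~r M := by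
  classical
  obtain ⟨g, hg⟩ := isConj_iff.1 h
  rw [← mk_toWord (x := g)] at hg
  exact isRotated_of_conj_mk isReduced_toWord hL hM hg

variable [DecidableEq α]

/-- The cyclic reduction of the reduced word of `g`. It represents the conjugacy class of `g` up
to rotation. -/
def cycWord (g : FreeGroup α) : List (α × Bool) := reduceCyclically g.toWord

/-- The cyclic length of `g`: the least length of a conjugate of `g`. -/
def cycNorm (g : FreeGroup α) : ℕ := (cycWord g).length

theorem isCyclicallyReduced_cycWord (g : FreeGroup α) : IsCyclicallyReduced (cycWord g) :=
  reduceCyclically.isCyclicallyReduced isReduced_toWord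

theorem isConj_mk_cycWord (g : FreeGroup α) : IsConj (mk (cycWord g)) g := by
  refine isConj_iff.2 ⟨mk (reduceCyclically.conjugator g.toWord), ?_⟩
  rw [inv_mk, mul_mk, mul_mk, cycWord, reduceCyclically.conj_conjugator_reduceCyclically,
    mk_toWord]

theorem cycWord_mk {L : List (α × Bool)} (h : IsCyclicallyReduced L) : cycWord (mk L) = L := by
  rw [cycWord, toWord_mk_of_isReduced h.isReduced, reduceCyclically_eq_self h]

theorem cycNorm_mk {L : List (α × Bool)} (h : IsCyclicallyReduced L) :
    cycNorm (mk L) = L.length := by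
  rw [cycNorm, cycWord_mk h]

theorem isRotated_cycWord {g h : FreeGroup α} (hgh : IsConj g h) : cycWord g ~r cycWord h :=
  isRotated_of_isConj (isCyclicallyReduced_cycWord g) (isCyclicallyReduced_cycWord h)
    (((isConj_mk_cycWord g).trans hgh).trans (isConj_mk_cycWord h).symm)

theorem cycNorm_congr {g h : FreeGroup α} (hgh : IsConj g h) : cycNorm g = cycNorm h :=
  (isRotated_cycWord hgh).perm.length_eq

theorem norm_eq_cycNorm_add (g : FreeGroup α) :
    g.norm = cycNorm g + 2 * (reduceCyclically.conjugator g.toWord).length := by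
  have h := congrArg List.length (reduceCyclically.conj_conjugator_reduceCyclically g.toWord)
  simp only [List.length_append, invRev_length] at h
  rw [FreeGroup.norm, cycNorm, cycWord]
  omega

theorem cycNorm_le_norm (g : FreeGroup α) : cycNorm g ≤ g.norm := by
  have := norm_eq_cycNorm_add g
  omega

theorem cycNorm_eq_norm_iff {g : FreeGroup α} :
    cycNorm g = g.norm ↔ IsCyclicallyReduced g.toWord := by
  refine ⟨fun h => ?_, fun h => by rw [cycNorm, cycWord, reduceCyclically_eq_self h,
    FreeGroup.norm]⟩
  have hlen := norm_eq_cycNorm_add g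
  have hnil : reduceCyclically.conjugator g.toWord = [] := List.length_eq_zero_iff.1 (by omega)
  have hword := reduceCyclically.conj_conjugator_reduceCyclically g.toWord
  rw [hnil, invRev_empty, List.nil_append, List.append_nil] at hword
  rw [← hword]
  exact isCyclicallyReduced_cycWord g

end CyclicWord

/-! ### Automorphisms of `F₂` and their classes modulo `J` -/

namespace F2

open FreeGroup hiding map_mul map_one map_inv
open CyclicWord

/-- The endomorphism of `F₂` that maps `a` to `u` and `b` to `v`. -/
def endo (u v : F2) : F2 →* F2 := FreeGroup.lift ![u, v]

@[simp] theorem endo_a (u v : F2) : endo u v a = u := by simp [endo, a]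

@[simp] theorem endo_b (u v : F2) : endo u v b = v := by simp [endo, b]

theorem hom_ext {M : Type*} [Monoid M] {f g : F2 →* M} (ha : f a = g a) (hb : f b = g b) :
    f = g :=
  FreeGroup.ext_hom _ _ (Fin.forall_fin_two.2 ⟨ha, hb⟩)

theorem aut_ext {φ ψ : MulAut F2} (ha : φ a = ψ a) (hb : φ b = ψ b) : φ = ψ :=
  MulEquiv.toMonoidHom_injective (hom_ext ha hb)

/-- The one-letter automorphism `a ↦ a`, `b ↦ ba`. -/
def shearB : MulAut F2 :=
  MonoidHom.toMulEquiv (endo a (b * a)) (endo a (b * a⁻¹)) (hom_ext (by simp) (by simp))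
    (hom_ext (by simp) (by simp))

/-- The permutation `a ↦ a`, `b ↦ b⁻¹`. -/
def flip : MulAut F2 :=
  MonoidHom.toMulEquiv (endo a b⁻¹) (endo a b⁻¹) (hom_ext (by simp) (by simp))
    (hom_ext (by simp) (by simp))

/-- The permutation `a ↦ b`, `b ↦ a`. -/
def swap : MulAut F2 :=
  MonoidHom.toMulEquiv (endo b a) (endo b a) (hom_ext (by simp) (by simp))
    (hom_ext (by simp) (by simp))

@[simp] theorem shearB_a : shearB a = a := by simp [shearB]
@[simp] theorem shearB_b : shearB b = b * a := by simp [shearB]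
@[simp] theorem shearB_symm_a : MulEquiv.symm shearB a = a := by simp [shearB]
@[simp] theorem shearB_symm_b : MulEquiv.symm shearB b = b * a⁻¹ := by simp [shearB]
@[simp] theorem flip_a : flip a = a := by simp [flip]
@[simp] theorem flip_b : flip b = b⁻¹ := by simp [flip]
@[simp] theorem swap_a : swap a = b := by simp [swap]
@[simp] theorem swap_b : swap b = a := by simp [swap]

@[simp] theorem swap_mul_swap : swap * swap = 1 := aut_ext (by simp) (by simp)
@[simp] theorem flip_mul_flip : flip * flip = 1 := aut_ext (by simp) (by simp)
@[simp] theorem swap_inv : swap⁻¹ = swap := inv_eq_of_mul_eq_one_left swap_mul_swap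
@[simp] theorem swap_swap (x : F2) : swap (swap x) = x := DFunLike.congr_fun swap_mul_swap x
@[simp] theorem flip_flip (x : F2) : flip (flip x) = x := DFunLike.congr_fun flip_mul_flip x

/-- The one-letter automorphism `a ↦ ab`, `b ↦ b`. -/
def shearA : MulAut F2 := swap * shearB * swap

@[simp] theorem shearA_a : shearA a = a * b := by simp [shearA]
@[simp] theorem shearA_b : shearA b = b := by simp [shearA]
theorem shearA_inv : shearA⁻¹ = swap * shearB⁻¹ * swap := by simp [shearA, mul_assoc]
@[simp] theorem shearA_symm_a : MulEquiv.symm shearA a = a * b⁻¹ := by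
  rw [MulEquiv.symm_apply_eq]; simp
@[simp] theorem shearA_symm_b : MulEquiv.symm shearA b = b := by
  rw [MulEquiv.symm_apply_eq]; simp

/-- The permutation `a ↦ a⁻¹`, `b ↦ b⁻¹`. -/
def negate : MulAut F2 := swap * flip * swap * flip

@[simp] theorem negate_a : negate a = a⁻¹ := by simp [negate]
@[simp] theorem negate_b : negate b = b⁻¹ := by simp [negate]

/-- The outer automorphism group of `F₂`. -/
abbrev Out : Type := MulAut F2 ⧸ Inn

/-- The class of an automorphism modulo inner automorphisms. -/
abbrev out : MulAut F2 →* Out := QuotientGroup.mk' Inn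

theorem conj_mem_Inn (h : F2) : MulAut.conj h ∈ Inn := ⟨h, rfl⟩

theorem out_eq_of_conj {φ ψ : MulAut F2} (h : F2) (ha : φ a = h * ψ a * h⁻¹)
    (hb : φ b = h * ψ b * h⁻¹) : out φ = out ψ := by
  have hφ : φ = MulAut.conj h * ψ := aut_ext (by simpa using ha) (by simpa using hb)
  have hconj : out (MulAut.conj h) = 1 := (QuotientGroup.eq_one_iff _).2 (conj_mem_Inn h)
  rw [hφ, map_mul, hconj, one_mul]

theorem isConj_of_out_eq {φ ψ : MulAut F2} (h : out φ = out ψ) (x : F2) :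
    IsConj (φ x) (ψ x) := by
  obtain ⟨g, hg⟩ := QuotientGroup.eq_iff_div_mem.1 h
  rw [eq_div_iff_mul_eq'] at hg
  exact (isConj_iff.2 ⟨g, by rw [← hg]; simp⟩ : IsConj (ψ x) (φ x)).symm

theorem isConj_map (φ : MulAut F2) {x y : F2} (h : IsConj x y) : IsConj (φ x) (φ y) :=
  φ.toMonoidHom.map_isConj h

theorem swap_mul_shearB : swap * shearB = shearA * swap := by simp [shearA, mul_assoc]

theorem swap_mul_shearA : swap * shearA = shearB * swap := by simp [shearA, ← mul_assoc]

theorem out_flip_mul_shearB : out (flip * shearB) = out (shearB⁻¹ * flip) :=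
  out_eq_of_conj a⁻¹ (by simp) (by simp)

theorem out_flip_mul_shearA : out (flip * shearA) = out (shearA⁻¹ * flip) :=
  out_eq_of_conj 1 (by simp) (by simp)

theorem out_negate_mul_shearB : out (negate * shearB) = out (shearB * negate) :=
  out_eq_of_conj a (by simp) (by simp)

theorem out_negate_mul_shearA : out (negate * shearA) = out (shearA * negate) :=
  out_eq_of_conj b (by simp) (by simp)

theorem out_shearA_inv_mul_shearB : out (shearA⁻¹ * shearB) = out (flip * swap * shearA) :=
  out_eq_of_conj b (by simp [mul_assoc]) (by simp [mul_assoc])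

theorem out_shearB_inv_mul_shearA : out (shearB⁻¹ * shearA) = out (swap * flip * shearB) :=
  out_eq_of_conj a (by simp [mul_assoc]) (by simp [mul_assoc])

theorem out_shearA_mul_shearB_inv : out (shearA * shearB⁻¹) = out (swap * flip * shearA⁻¹) :=
  out_eq_of_conj a (by simp [mul_assoc]) (by simp [mul_assoc])

theorem out_shearB_mul_shearA_inv : out (shearB * shearA⁻¹) = out (flip * swap * shearB⁻¹) :=
  out_eq_of_conj b (by simp [mul_assoc]) (by simp [mul_assoc])

theorem mem_letters_iff_exists {g : F2} : g ∈ letters ↔ ∃ x, g = mk [x] := by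
  constructor
  · rintro (rfl | rfl | rfl | rfl)
    exacts [⟨(0, true), rfl⟩, ⟨(1, true), rfl⟩, ⟨(0, false), rfl⟩, ⟨(1, false), rfl⟩]
  · rintro ⟨⟨i, s⟩, rfl⟩
    fin_cases i <;> cases s
    exacts [.inr (.inr (.inl rfl)), .inl rfl, .inr (.inr (.inr rfl)), .inr (.inl rfl)]

theorem mk_mem_letters (x : Fin 2 × Bool) : mk [x] ∈ letters := mem_letters_iff_exists.2 ⟨x, rfl⟩

theorem mem_letters_iff_norm_eq_one {g : F2} : g ∈ letters ↔ g.norm = 1 := by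
  refine ⟨?_, fun h => ?_⟩
  · rintro (rfl | rfl | rfl | rfl) <;> rfl
  · obtain ⟨x, hx⟩ := List.length_eq_one_iff.1 h
    rw [← mk_toWord (x := g), hx]
    exact mk_mem_letters x

theorem isPermutation_of_mapsTo {φ : MulAut F2} (h : ∀ x ∈ letters, φ x ∈ letters) :
    IsPermutation φ := by
  have hfin : letters.Finite := Set.toFinite {a, b, a⁻¹, b⁻¹}
  refine Set.eq_of_subset_of_ncard_le (Set.image_subset_iff.2 h) ?_ hfin
  rw [Set.ncard_image_of_injective _ φ.injective]

theorem isPermutation_of_mem {φ : MulAut F2} (ha : φ a ∈ letters) (hb : φ b ∈ letters) :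
    IsPermutation φ := by
  have hinv : ∀ x ∈ letters, x⁻¹ ∈ letters := by
    simp [letters]
  refine isPermutation_of_mapsTo ?_
  rintro x (rfl | rfl | rfl | rfl)
  · exact ha
  · exact hb
  · simpa using hinv _ ha
  · simpa using hinv _ hb

theorem IsPermutation.mul {φ ψ : MulAut F2} (hφ : IsPermutation φ) (hψ : IsPermutation ψ) :
    IsPermutation (φ * ψ) :=
  isPermutation_of_mapsTo fun _ hx => hφ.apply_mem (hψ.apply_mem hx)

theorem isPermutation_one : IsPermutation 1 := Set.image_id _

theorem isPermutation_flip : IsPermutation flip :=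
  isPermutation_of_mem (by simp [letters]) (by simp [letters])

theorem isPermutation_swap : IsPermutation swap :=
  isPermutation_of_mem (by simp [letters]) (by simp [letters])

theorem isPermutation_negate : IsPermutation negate :=
  isPermutation_of_mem (by simp [letters]) (by simp [letters])

/-- The permutations that fix `a` and `b` up to inversion. -/
def signs : Set (MulAut F2) := {1, negate, flip, negate * flip}

theorem isPermutation_of_mem_signs {ρ : MulAut F2} (h : ρ ∈ signs) : IsPermutation ρ := by
  rcases h with rfl | rfl | rfl | rfl
  exacts [isPermutation_one, isPermutation_negate, isPermutation_flip,
    isPermutation_negate.mul isPermutation_flip]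

theorem exists_sign_apply_eq (s t : Bool) :
    ∃ ρ ∈ signs, ρ a = mk [(0, s)] ∧ ρ b = mk [(1, t)] := by
  have ha : mk [((0 : Fin 2), true)] = a := rfl
  have hb : mk [((1 : Fin 2), true)] = b := rfl
  have ha' : mk [((0 : Fin 2), false)] = a⁻¹ := rfl
  have hb' : mk [((1 : Fin 2), false)] = b⁻¹ := rfl
  cases s <;> cases t <;> simp [signs, ha, hb, ha', hb']

theorem exists_sign_or_sign_mul_swap {x y : Fin 2 × Bool} (h : x.1 ≠ y.1) :
    ∃ ρ ∈ signs, ∃ σ, (σ = ρ ∨ σ = ρ * swap) ∧ σ a = mk [x] ∧ σ b = mk [y] := by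
  obtain ⟨i, s⟩ := x
  obtain ⟨j, t⟩ := y
  obtain ⟨rfl, rfl⟩ | ⟨rfl, rfl⟩ : i = 0 ∧ j = 1 ∨ i = 1 ∧ j = 0 := by
    simp only at h
    omega
  · obtain ⟨ρ, hρ, ha, hb⟩ := exists_sign_apply_eq s t
    exact ⟨ρ, hρ, ρ, .inl rfl, ha, hb⟩
  · obtain ⟨ρ, hρ, ha, hb⟩ := exists_sign_apply_eq t s
    exact ⟨ρ, hρ, ρ * swap, .inr rfl, by simpa using hb, by simpa using ha⟩

theorem exists_permutation_apply_eq {x y : Fin 2 × Bool} (h : x.1 ≠ y.1) :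
    ∃ π, IsPermutation π ∧ π a = mk [x] ∧ π b = mk [y] := by
  obtain ⟨ρ, hρ, σ, rfl | rfl, ha, hb⟩ := exists_sign_or_sign_mul_swap h
  · exact ⟨σ, isPermutation_of_mem_signs hρ, ha, hb⟩
  · exact ⟨ρ * swap, (isPermutation_of_mem_signs hρ).mul isPermutation_swap, ha, hb⟩

theorem fst_ne_of_apply {φ : MulAut F2} {x y : Fin 2 × Bool} (hx : φ a = mk [x])
    (hy : φ b = mk [y]) : x.1 ≠ y.1 := by
  intro h
  rcases eq_or_ne x.2 y.2 with h' | h'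
  · have hab : φ a = φ b := by rw [hx, hy, Prod.ext h h']
    exact absurd (φ.injective hab) (by decide)
  · have hxy : x = (y.1, !y.2) := Prod.ext h (Bool.eq_not.2 h')
    have hab : φ a = φ b⁻¹ := by
      rw [map_inv, hx, hy, hxy]
      rfl
    exact absurd (φ.injective hab) (by decide)

theorem IsPermutation.exists_sign {π : MulAut F2} (h : IsPermutation π) :
    ∃ ρ ∈ signs, π = ρ ∨ π = ρ * swap := by
  obtain ⟨x, hx⟩ := mem_letters_iff_exists.1 (h.apply_mem (.inl rfl : a ∈ letters))
  obtain ⟨y, hy⟩ := mem_letters_iff_exists.1 (h.apply_mem (.inr (.inl rfl) : b ∈ letters))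
  obtain ⟨ρ, hρ, σ, hσ, ha, hb⟩ := exists_sign_or_sign_mul_swap (fst_ne_of_apply hx hy)
  obtain rfl : π = σ := aut_ext (hx.trans ha.symm) (hy.trans hb.symm)
  exact ⟨ρ, hρ, hσ⟩

theorem IsPermutation.mem_J {π : MulAut F2} (h : IsPermutation π) : π ∈ J :=
  Subgroup.subset_closure (Or.inr h)

theorem mem_J_of_mem_Inn {φ : MulAut F2} (h : φ ∈ Inn) : φ ∈ J :=
  Subgroup.subset_closure (Or.inl h)

theorem flip_mem_J : flip ∈ J := isPermutation_flip.mem_J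

theorem swap_mem_J : swap ∈ J := isPermutation_swap.mem_J

theorem exists_permutation_of_mem_J {ψ : MulAut F2} (h : ψ ∈ J) :
    ∃ π, IsPermutation π ∧ out ψ = out π := by
  induction h using Subgroup.closure_induction with
  | mem ψ hψ =>
    rcases hψ with hψ | hψ
    · exact ⟨1, isPermutation_one, (QuotientGroup.eq_one_iff _).2 hψ⟩
    · exact ⟨ψ, hψ, rfl⟩
  | one => exact ⟨1, isPermutation_one, rfl⟩
  | mul φ ψ _ _ ihφ ihψ =>
    obtain ⟨π, hπ, hφ⟩ := ihφ
    obtain ⟨ρ, hρ, hψ⟩ := ihψ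
    exact ⟨π * ρ, hπ.mul hρ, by rw [map_mul, map_mul, hφ, hψ]⟩
  | inv φ _ ih =>
    obtain ⟨π, hπ, hφ⟩ := ih
    exact ⟨π⁻¹, hπ.inv, by rw [map_inv, map_inv, hφ]⟩

theorem JEquiv.of_isConj {x y : F2} (h : IsConj x y) : JEquiv x y := by
  obtain ⟨g, hg⟩ := isConj_iff.1 h
  exact ⟨MulAut.conj g, mem_J_of_mem_Inn (conj_mem_Inn g), hg⟩

theorem JEquiv.of_out_eq {φ ψ : MulAut F2} (h : out φ = out ψ) (x : F2) :
    JEquiv (φ x) (ψ x) := .of_isConj (isConj_of_out_eq h x)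

theorem jEquiv_apply {ψ : MulAut F2} (h : ψ ∈ J) (x : F2) : JEquiv x (ψ x) := ⟨ψ, h, rfl⟩

theorem jEquiv_flip (x : F2) : JEquiv x (flip x) := jEquiv_apply flip_mem_J x

theorem jEquiv_swap (x : F2) : JEquiv x (swap x) := jEquiv_apply swap_mem_J x

theorem JEquiv.of_out_mul {φ ψ π χ : MulAut F2} (hπ : π ∈ J) (h : out (φ * ψ) = out (π * χ))
    (x : F2) : JEquiv (φ (ψ x)) (χ x) :=
  (JEquiv.of_out_eq h x).trans (jEquiv_apply hπ (χ x)).symm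

theorem jEquiv_shearB_swap (x : F2) : JEquiv (shearB (swap x)) (shearA x) :=
  .of_out_mul swap_mem_J (congrArg out swap_mul_shearA.symm) x

theorem jEquiv_shearB_inv_swap (x : F2) : JEquiv (shearB⁻¹ (swap x)) (shearA⁻¹ x) :=
  .of_out_mul swap_mem_J (congrArg out (by simp [shearA_inv, ← mul_assoc])) x

theorem jEquiv_shearA_swap (x : F2) : JEquiv (shearA (swap x)) (shearB x) := by
  simpa only [swap_swap] using (jEquiv_shearB_swap (swap x)).symm

theorem jEquiv_shearB_inv_flip (x : F2) : JEquiv (shearB⁻¹ (flip x)) (shearB x) :=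
  .of_out_mul flip_mem_J out_flip_mul_shearB.symm x

theorem jEquiv_shearA_inv_flip (x : F2) : JEquiv (shearA⁻¹ (flip x)) (shearA x) :=
  .of_out_mul flip_mem_J out_flip_mul_shearA.symm x

theorem jEquiv_shearB_flip (x : F2) : JEquiv (shearB (flip x)) (shearB⁻¹ x) := by
  simpa only [flip_flip] using (jEquiv_shearB_inv_flip (flip x)).symm

theorem jEquiv_shearA_flip (x : F2) : JEquiv (shearA (flip x)) (shearA⁻¹ x) := by
  simpa only [flip_flip] using (jEquiv_shearA_inv_flip (flip x)).symm

theorem flip_mul_swap_mem_J : flip * swap ∈ J := J.mul_mem flip_mem_J swap_mem_J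

theorem swap_mul_flip_mem_J : swap * flip ∈ J := J.mul_mem swap_mem_J flip_mem_J

theorem jEquiv_shearB_inv_shearA (x : F2) : JEquiv (shearB⁻¹ (shearA x)) (shearB x) :=
  .of_out_mul swap_mul_flip_mem_J out_shearB_inv_mul_shearA x

theorem jEquiv_shearA_inv_shearB (x : F2) : JEquiv (shearA⁻¹ (shearB x)) (shearA x) :=
  .of_out_mul flip_mul_swap_mem_J out_shearA_inv_mul_shearB x

theorem jEquiv_shearA_shearB_inv (x : F2) : JEquiv (shearA (shearB⁻¹ x)) (shearA⁻¹ x) :=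
  .of_out_mul swap_mul_flip_mem_J out_shearA_mul_shearB_inv x

theorem jEquiv_shearB_shearA_inv (x : F2) : JEquiv (shearB (shearA⁻¹ x)) (shearB⁻¹ x) :=
  .of_out_mul flip_mul_swap_mem_J out_shearB_mul_shearA_inv x

theorem JEquiv.congr_of_invariant {β : Type*} {f : F2 → β}
    (hconj : ∀ x y, IsConj x y → f x = f y) (hflip : ∀ x, f (flip x) = f x)
    (hswap : ∀ x, f (swap x) = f x) {x y : F2} (h : JEquiv x y) : f x = f y := by
  obtain ⟨ψ, hψ, rfl⟩ := h
  obtain ⟨π, hπ, hψπ⟩ := exists_permutation_of_mem_J hψ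
  rw [hconj _ _ (isConj_of_out_eq hψπ x)]
  obtain ⟨ρ, hρ, hπρ⟩ := hπ.exists_sign
  have hsign : ∀ x, f (ρ x) = f x := by
    rcases hρ with rfl | rfl | rfl | rfl <;>
      simp only [MulAut.mul_apply, MulAut.one_apply, negate, hflip, hswap, implies_true]
  rcases hπρ with rfl | rfl
  · exact (hsign x).symm
  · rw [MulAut.mul_apply, hsign, hswap]

/-- Representatives of the one-letter automorphisms modulo inner automorphisms. -/
def move : Fin 4 → MulAut F2 := ![shearB, shearA, shearB⁻¹, shearA⁻¹]

theorem move_zero : move 0 = shearB := rfl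
theorem move_one : move 1 = shearA := rfl
theorem move_two : move 2 = shearB⁻¹ := rfl

theorem isOneLetter_move (i : Fin 4) : IsOneLetter (move i) := by
  fin_cases i
  · exact ⟨a, by simp [letters], b, by simp [letters], by decide, by decide, by simp [move],
      by simp [move]⟩
  · exact ⟨b, by simp [letters], a, by simp [letters], by decide, by decide, by simp [move],
      by simp [move]⟩
  · exact ⟨a⁻¹, by simp [letters], b, by simp [letters], by decide, by decide, by simp [move],
      by simp [move]⟩
  · exact ⟨b⁻¹, by simp [letters], a, by simp [letters], by decide, by decide, by simp [move],
      by simp [move]⟩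

theorem IsOneLetter.exists_move {φ : MulAut F2} (h : IsOneLetter φ) :
    ∃ i, out φ = out (move i) := by
  obtain ⟨x, hx, y, hy, hyx, hyx', hφx, hφy⟩ := h
  rcases hx with rfl | rfl | rfl | rfl <;> rcases hy with rfl | rfl | rfl | rfl <;>
    first
      | exact absurd rfl hyx
      | exact absurd rfl hyx'
      | exact absurd (inv_inv _).symm hyx'
      | skip
  · exact ⟨0, out_eq_of_conj 1 (by simp [move, hφx]) (by simp [move, hφy])⟩
  · rw [map_inv, inv_eq_iff_eq_inv] at hφy
    exact ⟨2, out_eq_of_conj a⁻¹ (by simp [move, hφx]) (by simp [move, hφy, mul_assoc])⟩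
  · exact ⟨1, out_eq_of_conj 1 (by simp [move, hφy]) (by simp [move, hφx])⟩
  · rw [map_inv, inv_eq_iff_eq_inv] at hφy
    exact ⟨3, out_eq_of_conj b⁻¹ (by simp [move, hφy, mul_assoc]) (by simp [move, hφx])⟩
  · rw [map_inv, inv_inj] at hφx
    exact ⟨2, out_eq_of_conj 1 (by simp [move, hφx]) (by simp [move, hφy])⟩
  · rw [map_inv, inv_eq_iff_eq_inv] at hφy
    rw [map_inv, inv_inj] at hφx
    exact ⟨0, out_eq_of_conj a (by simp [move, hφx]) (by simp [move, hφy, mul_assoc])⟩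
  · rw [map_inv, inv_inj] at hφx
    exact ⟨3, out_eq_of_conj 1 (by simp [move, hφy]) (by simp [move, hφx])⟩
  · rw [map_inv, inv_eq_iff_eq_inv] at hφy
    rw [map_inv, inv_inj] at hφx
    exact ⟨1, out_eq_of_conj b (by simp [move, hφy, mul_assoc]) (by simp [move, hφx])⟩

/-- The exponent sum of the `i`-th generator, a conjugacy invariant. -/
def expSum (i : Fin 2) : F2 →* Multiplicative ℤ :=
  FreeGroup.lift (Pi.mulSingle i (Multiplicative.ofAdd 1))

@[simp] theorem expSum_a (i : Fin 2) :
    expSum i a = Multiplicative.ofAdd (if i = 0 then 1 else 0) := by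
  fin_cases i <;> rfl

@[simp] theorem expSum_b (i : Fin 2) :
    expSum i b = Multiplicative.ofAdd (if i = 1 then 1 else 0) := by
  fin_cases i <;> rfl

theorem expSum_move (i : Fin 4) : expSum 1 (move i a) = Multiplicative.ofAdd (![0, 1, 0, -1] i) ∧
    expSum 0 (move i b) = Multiplicative.ofAdd (![1, 0, -1, 0] i) := by
  fin_cases i <;> simp [move]

theorem out_move_injective : Function.Injective fun i => out (move i) := by
  have hconj (k : Fin 2) {x y : F2} (h : IsConj x y) : expSum k x = expSum k y :=
    isConj_iff_eq.1 ((expSum k).map_isConj h)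
  intro i j hij
  have ha := hconj 1 (isConj_of_out_eq hij a)
  have hb := hconj 0 (isConj_of_out_eq hij b)
  rw [(expSum_move i).1, (expSum_move j).1] at ha
  rw [(expSum_move i).2, (expSum_move j).2] at hb
  clear hij
  revert i j
  decide

theorem edgeCount_eq_card (w v : F2) [DecidablePred fun i => JEquiv (move i w) v] :
    edgeCount w v = (Finset.univ.filter fun i => JEquiv (move i w) v).card := by
  unfold edgeCount
  rw [← Set.ncard_coe_finset, ← Set.ncard_image_of_injective _ out_move_injective]
  congr 1
  ext q
  simp only [edgeClasses, Set.mem_ofPred_eq, Set.mem_image, Finset.coe_filter, Finset.mem_univ,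
    true_and]
  constructor
  · rintro ⟨φ, hφ, rfl, h⟩
    obtain ⟨i, hi⟩ := hφ.exists_move
    exact ⟨i, (JEquiv.of_out_eq hi w).symm.trans h, hi.symm⟩
  · rintro ⟨i, h, rfl⟩
    exact ⟨move i, isOneLetter_move i, rfl, h⟩

theorem exists_move_mul_eq {j : MulAut F2} (hj : j ∈ J) (i : Fin 4) :
    ∃ k, out (move i * j) = out (j * move k) := by
  obtain ⟨π, hπ, hjπ⟩ := exists_permutation_of_mem_J hj
  obtain ⟨k, hk⟩ := ((isOneLetter_move i).conj hπ.inv).exists_move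
  refine ⟨k, ?_⟩
  simp only [map_mul, inv_inv, map_inv] at hk ⊢
  rw [hjπ, ← hk]
  group

theorem JEquiv.exists_move {x y : F2} (h : JEquiv x y) (i : Fin 4) :
    ∃ k, JEquiv (move i x) (move k y) := by
  obtain ⟨j, hj, rfl⟩ := h.symm
  obtain ⟨k, hk⟩ := exists_move_mul_eq hj i
  exact ⟨k, (JEquiv.of_out_eq hk y).trans (jEquiv_apply hj _).symm⟩

end F2

/-! ### Lengths of images under one-letter automorphisms -/

namespace CyclicWord

open FreeGroup

section Unroll

variable {α β : Type*} [Inhabited α] [Inhabited β]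

/-- The periodic sequence of the entries of a cyclic word (constantly the default value for the
empty word). -/
def unroll (L : List α) (i : ℕ) : α := L.getI (i % L.length)

theorem unroll_periodic (L : List α) : Function.Periodic (unroll L) L.length := fun i => by
  simp only [unroll, Nat.add_mod_right]

theorem getElem?_rotate_eq_unroll {L : List α} {j : ℕ} (hj : j < L.length) (i : ℕ) :
    (L.rotate i)[j]? = some (unroll L (j + i)) := by
  have hlt : (j + i) % L.length < L.length := Nat.mod_lt _ (by omega)
  rw [List.getElem?_rotate hj, List.getElem?_eq_getElem hlt, unroll, List.getI_eq_getElem L hlt]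

theorem unroll_rotate (L : List α) (r i : ℕ) : unroll (L.rotate r) i = unroll L (i + r) := by
  rcases eq_or_ne L [] with rfl | hL
  · simp [unroll]
  have hlt : i % L.length < L.length := Nat.mod_lt _ (List.length_pos_of_ne_nil hL)
  rw [unroll, List.length_rotate, List.getI_eq_getElem?_getD, getElem?_rotate_eq_unroll hlt,
    Option.getD_some, unroll, unroll, Nat.mod_add_mod]

theorem unroll_map {L : List α} (hL : L ≠ []) (f : α → β) (i : ℕ) :
    unroll (L.map f) i = f (unroll L i) := by
  have hlt : i % L.length < L.length := Nat.mod_lt _ (List.length_pos_of_ne_nil hL)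
  rw [unroll, List.length_map, List.getI_eq_getElem _ (by simpa using hlt), List.getElem_map,
    unroll, List.getI_eq_getElem _ hlt]

theorem map_unroll_range (L : List α) : (List.range L.length).map (unroll L) = L := by
  refine List.ext_getElem (by simp) fun i _ hi => ?_
  simp [unroll, Nat.mod_eq_of_lt hi, List.getI_eq_getElem _ hi]

theorem rel_unroll {R : α → α → Prop} {L : List α} (hL : L ≠ []) (h : (L ++ L).IsChain R)
    (i : ℕ) : R (unroll L i) (unroll L (i + 1)) := by
  have hpos := List.length_pos_of_ne_nil hL
  have hlt := Nat.mod_lt i hpos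
  have hget (j : ℕ) (hj : j < (L ++ L).length) : (L ++ L)[j] = unroll L j := by
    rw [List.length_append] at hj
    rw [unroll, List.getI_eq_getElem _ (Nat.mod_lt j hpos)]
    rcases lt_or_ge j L.length with hj' | hj'
    · simp only [List.getElem_append_left hj', Nat.mod_eq_of_lt hj']
    · simp only [List.getElem_append_right hj', Nat.mod_eq_sub_mod hj',
        Nat.mod_eq_of_lt (show j - L.length < L.length by omega)]
  have hR := List.isChain_iff_getElem.1 h (i % L.length) (by rw [List.length_append]; omega)
  rw [hget, hget] at hR
  simpa only [unroll, Nat.mod_mod, Nat.mod_add_mod] using hR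

theorem pair_prefix_rotate_iff {L : List α} (hL : 2 ≤ L.length) (i : ℕ) (x y : α) :
    [x, y] <+: L.rotate i ↔ unroll L i = x ∧ unroll L (i + 1) = y := by
  have h0 := getElem?_rotate_eq_unroll (show 0 < L.length by omega) i
  have h1 := getElem?_rotate_eq_unroll (show 1 < L.length by omega) i
  rw [zero_add] at h0
  rw [add_comm] at h1
  generalize L.rotate i = M at h0 h1
  match M with
  | [] => simp at h0
  | [_] => simp at h1
  | z :: t :: M =>
    simp only [List.getElem?_cons_zero, List.getElem?_cons_succ, Option.some.injEq] at h0 h1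
    simp [List.cons_prefix_cons, ← h0, ← h1, eq_comm]

end Unroll

section CycSum

variable {α β M : Type*} [Inhabited α] [Inhabited β]

/-- The sum of `f x y` over the pairs of consecutive entries of a cyclic word. -/
def cycSum [AddCommMonoid M] (f : α → α → M) (L : List α) : M :=
  ∑ i ∈ Finset.range L.length, f (unroll L i) (unroll L (i + 1))

theorem cycSum_neg [AddCommGroup M] (f : α → α → M) (L : List α) :
    cycSum (fun x y => -f x y) L = -cycSum f L := Finset.sum_neg_distrib _

theorem cycSum_map [AddCommMonoid M] (f : β → β → M) (π : α → β) (L : List α) :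
    cycSum f (L.map π) = cycSum (fun x y => f (π x) (π y)) L := by
  rcases eq_or_ne L [] with rfl | hL
  · rfl
  simp only [cycSum, List.length_map, unroll_map hL]

theorem cycSum_nonneg [AddCommMonoid M] [PartialOrder M] [IsOrderedAddMonoid M] {f : α → α → M}
    (hf : ∀ x y, 0 ≤ f x y) (L : List α) : 0 ≤ cycSum f L :=
  Finset.sum_nonneg fun _ _ => hf _ _

theorem eq_zero_of_cycSum_eq_zero [AddCommMonoid M] [PartialOrder M] [IsOrderedAddMonoid M]
    {f : α → α → M} (hf : ∀ x y, 0 ≤ f x y) {L : List α} (hL : L ≠ []) (h : cycSum f L = 0)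
    (i : ℕ) : f (unroll L i) (unroll L (i + 1)) = 0 := by
  have hlt := Nat.mod_lt i (List.length_pos_of_ne_nil hL)
  have := (Finset.sum_eq_zero_iff_of_nonneg fun _ _ => hf _ _).1 h _ (Finset.mem_range.2 hlt)
  simpa only [unroll, Nat.mod_mod, Nat.mod_add_mod] using this

theorem sum_range_add_of_periodic [AddCommGroup M] {f : ℕ → M} {n : ℕ}
    (hf : Function.Periodic f n) (r : ℕ) :
    ∑ i ∈ Finset.range n, f (i + r) = ∑ i ∈ Finset.range n, f i := by
  induction r with
  | zero => rfl
  | succ r ih =>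
    rw [← ih, ← add_left_inj (f r)]
    have hr : f (n + r) = f r := by rw [add_comm, hf]
    calc ∑ i ∈ Finset.range n, f (i + (r + 1)) + f r
        = ∑ i ∈ Finset.range (n + 1), f (i + r) := by
          simp only [Finset.sum_range_succ', zero_add, add_assoc, add_comm 1]
      _ = ∑ i ∈ Finset.range n, f (i + r) + f r := by rw [Finset.sum_range_succ, hr]

theorem cycSum_eq_of_isRotated [AddCommGroup M] (f : α → α → M) {L L' : List α} (h : L ~r L') :
    cycSum f L = cycSum f L' := by
  obtain ⟨r, rfl⟩ := h
  simp only [cycSum, List.length_rotate, unroll_rotate, add_right_comm]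
  refine (sum_range_add_of_periodic (f := fun i => f (unroll L i) (unroll L (i + 1)))
    (fun i => ?_) r).symm
  change f (unroll L (i + L.length)) (unroll L (i + L.length + 1)) = _
  rw [add_right_comm, unroll_periodic, unroll_periodic]

theorem cycSum_eq_of_coboundary [AddCommGroup M] {f g : α → α → M} (h : α → M)
    {R : α → α → Prop} (hfg : ∀ x y, R x y → f x y = g x y + (h y - h x)) {L : List α}
    (hL : ∀ i, R (unroll L i) (unroll L (i + 1))) : cycSum f L = cycSum g L := by
  have htel : ∑ i ∈ Finset.range L.length, (h (unroll L (i + 1)) - h (unroll L i)) = 0 := by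
    rw [Finset.sum_range_sub fun i => h (unroll L i), (unroll_periodic L).eq, sub_self]
  rw [cycSum, Finset.sum_congr rfl fun i _ => hfg _ _ (hL i), Finset.sum_add_distrib, htel,
    add_zero, cycSum]

end CycSum

/-- The letters `x` and `y` may stand next to each other in a reduced word. -/
abbrev Compatible {α : Type*} (x y : α × Bool) : Prop := x.1 = y.1 → x.2 = y.2

theorem compatible_unroll {α : Type*} [Inhabited α] {L : List (α × Bool)}
    (h : IsCyclicallyReduced L) (i : ℕ) : Compatible (unroll L i) (unroll L (i + 1)) := by
  rcases eq_or_ne L [] with rfl | hL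
  · simp [unroll]
  · exact rel_unroll hL (isCyclicallyReduced_iff_append_self.1 h) i

theorem isCyclicallyReduced_map {α β : Type*} {π : α × Bool → β × Bool}
    (hπ : ∀ x y, Compatible x y → Compatible (π x) (π y)) {L : List (α × Bool)}
    (h : IsCyclicallyReduced L) : IsCyclicallyReduced (L.map π) := by
  rw [isCyclicallyReduced_iff_append_self, ← List.map_append]
  exact List.isChain_map_of_isChain π hπ (isCyclicallyReduced_iff_append_self.1 h)

end CyclicWord

namespace F2

open FreeGroup hiding map_mul map_one map_inv
open CyclicWord

/-- The word that the junction of the letters `x` and `y` of a cyclic word contributes to its image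
under `shearB`: the image of `x` without what cancels against, or is credited to, its neighbours. -/
def chunk (x y : Fin 2 × Bool) : List (Fin 2 × Bool) :=
  if x = (1, true) then (if y = (0, false) then [(1, true)] else [(1, true), (0, true)])
  else if x = (1, false) then (if y = (0, true) then [(1, false)] else [(1, false), (0, false)])
  else if x = (0, true) then (if y = (1, false) then [] else [(0, true)])
  else (if y = (1, true) then [] else [(0, false)])

/-- The concatenation of the chunks at the first `n` junctions of the sequence `e`. -/
def transduce (e : ℕ → Fin 2 × Bool) (n : ℕ) : List (Fin 2 × Bool) :=
  (List.range n).flatMap fun i => chunk (e i) (e (i + 1))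

theorem transduce_succ (e : ℕ → Fin 2 × Bool) (n : ℕ) :
    transduce e (n + 1) = transduce e n ++ chunk (e n) (e (n + 1)) := by
  simp [transduce, List.range_succ]

theorem transduce_add (e : ℕ → Fin 2 × Bool) (m n : ℕ) :
    transduce e (m + n) = transduce e m ++ transduce (fun i => e (m + i)) n := by
  simp [transduce, List.range_add, List.flatMap_map, add_assoc]

theorem length_transduce (e : ℕ → Fin 2 × Bool) (n : ℕ) :
    (transduce e n).length = ∑ i ∈ Finset.range n, (chunk (e i) (e (i + 1))).length := by
  induction n with
  | zero => rfl
  | succ n ih => rw [transduce_succ, List.length_append, ih, Finset.sum_range_succ]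

/-- The letters with which the image of a reduced word that begins with `x` can begin. -/
abbrev Leads (x h : Fin 2 × Bool) : Prop := h = x ∨ (x.1 = 0 ∧ h = (1, !x.2))

theorem chunk_isChain : ∀ x y : Fin 2 × Bool, Compatible x y →
    (chunk x y).IsChain Compatible ∧ ∀ k ∈ (chunk x y).head?, Leads x k := by
  decide

theorem chunk_concat_isChain : ∀ x y h : Fin 2 × Bool, Compatible x y → Leads y h →
    (chunk x y ++ [h]).IsChain Compatible ∧ ∀ k ∈ (chunk x y ++ [h]).head?, Leads x k := by
  decide

theorem isReduced_transduce {e : ℕ → Fin 2 × Bool} (he : ∀ i, Compatible (e i) (e (i + 1)))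
    (n : ℕ) : IsReduced (transduce e n) ∧ ∀ h ∈ (transduce e n).head?, Leads (e 0) h := by
  induction n generalizing e with
  | zero => simp [transduce]
  | succ n ih =>
    obtain ⟨hred, hlead⟩ := ih fun i => he (1 + i)
    rw [add_comm, transduce_add, transduce_succ]
    generalize transduce (fun i => e (1 + i)) n = T at hred hlead
    cases T with
    | nil => exact (List.append_nil _).symm ▸ chunk_isChain _ _ (he 0)
    | cons h T =>
      obtain ⟨hchain, hhead⟩ := chunk_concat_isChain _ _ h (he 0) (hlead h rfl)
      refine ⟨?_, fun k hk => hhead k ?_⟩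
      · simpa [transduce] using FreeGroup.IsReduced.append_overlap (L₁ := chunk (e 0) (e 1))
          (L₂ := [h]) (L₃ := T) hchain hred (by simp)
      · simpa [transduce, List.head?_append] using hk

/-- The correction at a letter that turns the letterwise image of a word into its chunks. -/
def correction (x : Fin 2 × Bool) : F2 := if x.2 then 1 else a⁻¹

theorem shearB_mk_singleton_mul_correction {x y : Fin 2 × Bool} (h : Compatible x y) :
    shearB (mk [x]) * correction y = correction x * mk (chunk x y) := by
  have ha : mk [((0 : Fin 2), true)] = a := rfl
  have hb : mk [((1 : Fin 2), true)] = b := rfl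
  have hA : mk [((0 : Fin 2), false)] = a⁻¹ := rfl
  have hB : mk [((1 : Fin 2), false)] = b⁻¹ := rfl
  have hba : mk [((1 : Fin 2), true), (0, true)] = b * a := rfl
  have hBA : mk [((1 : Fin 2), false), (0, false)] = b⁻¹ * a⁻¹ := rfl
  revert h
  obtain ⟨i, s⟩ := x
  obtain ⟨j, t⟩ := y
  fin_cases i <;> fin_cases j <;> cases s <;> cases t <;>
    simp [chunk, correction, ha, hb, hA, hB, hba, hBA, ← one_eq_mk, mul_assoc]

theorem shearB_mk_mul_correction {e : ℕ → Fin 2 × Bool} (he : ∀ i, Compatible (e i) (e (i + 1)))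
    (n : ℕ) : shearB (mk ((List.range n).map e)) * correction (e n) =
      correction (e 0) * mk (transduce e n) := by
  induction n with
  | zero => simp [transduce, ← one_eq_mk]
  | succ n ih =>
    rw [List.range_succ, List.map_append, List.map_singleton, ← mul_mk, map_mul, mul_assoc,
      shearB_mk_singleton_mul_correction (he n), ← mul_assoc, ih, mul_assoc, mul_mk,
      transduce_succ]

/-- The cyclic word of the image of a cyclic word under `shearB`. -/
def cycTransduce (L : List (Fin 2 × Bool)) : List (Fin 2 × Bool) :=
  transduce (unroll L) L.length

theorem length_cycTransduce (L : List (Fin 2 × Bool)) :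
    (cycTransduce L).length = cycSum (fun x y => (chunk x y).length) L :=
  length_transduce _ _

theorem isCyclicallyReduced_cycTransduce {L : List (Fin 2 × Bool)} (h : IsCyclicallyReduced L) :
    IsCyclicallyReduced (cycTransduce L) := by
  have hperiod : (fun i => unroll L (L.length + i)) = unroll L :=
    funext fun i => by rw [add_comm, unroll_periodic]
  rw [isCyclicallyReduced_iff_append_self]
  nth_rewrite 2 [cycTransduce]
  rw [← hperiod, cycTransduce, ← transduce_add]
  exact (isReduced_transduce (compatible_unroll h) _).1

theorem isConj_shearB_mk {L : List (Fin 2 × Bool)} (h : IsCyclicallyReduced L) :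
    IsConj (shearB (mk L)) (mk (cycTransduce L)) := by
  have key := shearB_mk_mul_correction (compatible_unroll h) L.length
  rw [map_unroll_range, (unroll_periodic L).eq] at key
  refine isConj_iff.2 ⟨(correction (unroll L 0))⁻¹, ?_⟩
  rw [inv_inv, mul_assoc, key, inv_mul_cancel_left, cycTransduce]

/-- The indicator of the pairs `aa`, `a⁻¹a⁻¹` (for `i = 0`) and `bb`, `b⁻¹b⁻¹` (for `i = 1`). -/
def square (i : Fin 2) (x y : Fin 2 × Bool) : ℤ := if x = y ∧ x.1 = i then 1 else 0

/-- The function that is `1` at the pairs `ab`, `b⁻¹a⁻¹`, and `-1` at the pairs `ab⁻¹`, `ba⁻¹`. -/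
def turn (x y : Fin 2 × Bool) : ℤ :=
  if x = (0, true) ∧ y = (1, true) ∨ x = (1, false) ∧ y = (0, false) then 1
  else if x = (0, true) ∧ y = (1, false) ∨ x = (1, true) ∧ y = (0, false) then -1 else 0

theorem square_nonneg (i : Fin 2) (x y : Fin 2 × Bool) : 0 ≤ square i x y := by
  unfold square; split_ifs <;> simp

/-- The number of occurrences of `aa` (for `i = 0`) or `bb` (for `i = 1`) and of their inverses in
the cyclic word of `g`. -/
def squares (i : Fin 2) (g : F2) : ℤ := cycSum (square i) (cycWord g)

/-- The difference of the numbers of occurrences of `ab` and `ab⁻¹` and their inverses in the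
cyclic word of `g`. -/
def turns (g : F2) : ℤ := cycSum turn (cycWord g)

theorem squares_nonneg (i : Fin 2) (g : F2) : 0 ≤ squares i g := cycSum_nonneg (square_nonneg i) _

theorem cycNorm_shearB_mk {L : List (Fin 2 × Bool)} (h : IsCyclicallyReduced L) :
    (cycNorm (shearB (mk L)) : ℤ) = cycSum (fun x y => 1 + square 1 x y + turn x y) L := by
  rw [cycNorm_congr (isConj_shearB_mk h), cycNorm_mk (isCyclicallyReduced_cycTransduce h),
    length_cycTransduce, cycSum, Nat.cast_sum]
  refine cycSum_eq_of_coboundary (f := fun x y => ((chunk x y).length : ℤ))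
    (fun x => if x = (1, true) then 0 else 1) ?_ (compatible_unroll h)
  decide

/-- The automorphism `π` maps each letter `x` to the letter `f x`. Letters as elements of the
alphabet, unlike letters as group elements, can be treated by `decide`. -/
structure ActsOnLetters (π : MulAut F2) (f : Fin 2 × Bool → Fin 2 × Bool) : Prop where
  apply_mk_singleton : ∀ x, π (mk [x]) = mk [f x]
  compatible : ∀ x y, Compatible x y → Compatible (f x) (f y)

theorem ActsOnLetters.mul {π ρ : MulAut F2} {f f' : Fin 2 × Bool → Fin 2 × Bool}
    (hπ : ActsOnLetters π f) (hρ : ActsOnLetters ρ f') : ActsOnLetters (π * ρ) (f ∘ f') where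
  apply_mk_singleton x := by
    rw [MulAut.mul_apply, hρ.apply_mk_singleton, hπ.apply_mk_singleton, Function.comp_apply]
  compatible x y h := hπ.compatible _ _ (hρ.compatible x y h)

theorem actsOnLetters_flip : ActsOnLetters flip fun x => if x.1 = 1 then (1, !x.2) else x where
  apply_mk_singleton := by
    rintro ⟨i, s⟩
    fin_cases i <;> cases s
    · change flip a⁻¹ = a⁻¹; simp
    · change flip a = a; simp
    · change flip b⁻¹ = b; simp
    · change flip b = b⁻¹; simp
  compatible := by decide

theorem actsOnLetters_swap : ActsOnLetters swap fun x => (x.1 + 1, x.2) where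
  apply_mk_singleton := by
    rintro ⟨i, s⟩
    fin_cases i <;> cases s
    · change swap a⁻¹ = b⁻¹; simp
    · change swap a = b; simp
    · change swap b⁻¹ = a⁻¹; simp
    · change swap b = a; simp
  compatible := by decide

theorem ActsOnLetters.apply_mk {π : MulAut F2} {f : Fin 2 × Bool → Fin 2 × Bool}
    (h : ActsOnLetters π f) (L : List (Fin 2 × Bool)) :
    π (FreeGroup.mk L) = FreeGroup.mk (L.map f) := by
  induction L with
  | nil => rw [List.map_nil, ← one_eq_mk, map_one]
  | cons x l ih =>
    rw [← List.singleton_append, ← mul_mk, map_mul, ih, h.apply_mk_singleton, mul_mk]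
    rfl

theorem ActsOnLetters.isCyclicallyReduced_map {π : MulAut F2} {f : Fin 2 × Bool → Fin 2 × Bool}
    (h : ActsOnLetters π f) (g : F2) : IsCyclicallyReduced ((cycWord g).map f) :=
  CyclicWord.isCyclicallyReduced_map h.compatible (isCyclicallyReduced_cycWord g)

theorem ActsOnLetters.isConj_apply {π : MulAut F2} {f : Fin 2 × Bool → Fin 2 × Bool}
    (h : ActsOnLetters π f) (g : F2) : IsConj (π g) (FreeGroup.mk ((cycWord g).map f)) := by
  rw [← h.apply_mk]
  exact isConj_map π (isConj_mk_cycWord g).symm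

theorem ActsOnLetters.cycNorm_apply {π : MulAut F2} {f : Fin 2 × Bool → Fin 2 × Bool}
    (h : ActsOnLetters π f) (g : F2) : cycNorm (π g) = cycNorm g := by
  rw [cycNorm_congr (h.isConj_apply g), cycNorm_mk (h.isCyclicallyReduced_map g),
    List.length_map, cycNorm]

theorem cycNorm_flip (g : F2) : cycNorm (flip g) = cycNorm g := actsOnLetters_flip.cycNorm_apply g

theorem cycNorm_swap (g : F2) : cycNorm (swap g) = cycNorm g := actsOnLetters_swap.cycNorm_apply g

theorem cycNorm_congr_J {x y : F2} (h : JEquiv x y) : cycNorm x = cycNorm y :=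
  h.congr_of_invariant (fun _ _ => cycNorm_congr) cycNorm_flip cycNorm_swap

theorem ActsOnLetters.cycSum_apply {M : Type*} [AddCommGroup M] {π : MulAut F2}
    {f : Fin 2 × Bool → Fin 2 × Bool} (h : ActsOnLetters π f)
    (F : Fin 2 × Bool → Fin 2 × Bool → M) (g : F2) :
    cycSum F (cycWord (π g)) = cycSum (fun x y => F (f x) (f y)) (cycWord g) := by
  have hrot := isRotated_cycWord (h.isConj_apply g)
  rw [cycWord_mk (h.isCyclicallyReduced_map g)] at hrot
  rw [cycSum_eq_of_isRotated F hrot, cycSum_map]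

theorem squares_congr (i : Fin 2) {g g' : F2} (h : IsConj g g') : squares i g = squares i g' :=
  cycSum_eq_of_isRotated _ (isRotated_cycWord h)

theorem squares_flip (i : Fin 2) (g : F2) : squares i (flip g) = squares i g := by
  rw [squares, actsOnLetters_flip.cycSum_apply]
  exact cycSum_eq_of_coboundary (fun _ => 0) (by decide +revert)
    (compatible_unroll (isCyclicallyReduced_cycWord g))

theorem squares_swap (i : Fin 2) (g : F2) : squares i (swap g) = squares (i + 1) g := by
  rw [squares, actsOnLetters_swap.cycSum_apply]
  exact cycSum_eq_of_coboundary (fun _ => 0) (by decide +revert)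
    (compatible_unroll (isCyclicallyReduced_cycWord g))

theorem turns_flip (g : F2) : turns (flip g) = -turns g := by
  rw [turns, turns, ← cycSum_neg, actsOnLetters_flip.cycSum_apply]
  exact cycSum_eq_of_coboundary (fun _ => 0) (by decide)
    (compatible_unroll (isCyclicallyReduced_cycWord g))

theorem turns_swap (g : F2) : turns (swap g) = turns g := by
  rw [turns, actsOnLetters_swap.cycSum_apply]
  exact cycSum_eq_of_coboundary (fun x => if x = (0, true) ∨ x = (1, false) then 1 else 0)
    (by decide) (compatible_unroll (isCyclicallyReduced_cycWord g))

theorem cycNorm_shearB (g : F2) :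
    (cycNorm (shearB g) : ℤ) = cycNorm g + squares 1 g + turns g := by
  rw [cycNorm_congr (isConj_map shearB (isConj_mk_cycWord g).symm),
    cycNorm_shearB_mk (isCyclicallyReduced_cycWord g)]
  simp [cycSum, squares, turns, cycNorm, Finset.sum_add_distrib]

theorem cycNorm_shearA (g : F2) :
    (cycNorm (shearA g) : ℤ) = cycNorm g + squares 0 g + turns g := by
  rw [← cycNorm_congr_J (jEquiv_shearB_swap g), cycNorm_shearB, cycNorm_swap, squares_swap,
    turns_swap]
  rfl

theorem cycNorm_shearB_inv (g : F2) :
    (cycNorm (shearB⁻¹ g) : ℤ) = cycNorm g + squares 1 g - turns g := by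
  rw [← cycNorm_congr_J (jEquiv_shearB_flip g), cycNorm_shearB, cycNorm_flip, squares_flip,
    turns_flip, ← sub_eq_add_neg]

theorem cycNorm_shearA_inv (g : F2) :
    (cycNorm (shearA⁻¹ g) : ℤ) = cycNorm g + squares 0 g - turns g := by
  rw [← cycNorm_congr_J (jEquiv_shearA_flip g), cycNorm_shearA, cycNorm_flip, squares_flip,
    turns_flip, ← sub_eq_add_neg]

end F2

/-! ### Nielsen's theorem -/

namespace CyclicWord

open FreeGroup

section LcpLength

variable {β : Type*} [DecidableEq β]

/-- The length of the longest common prefix of two lists. -/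
def lcpLength : List β → List β → ℕ
  | x :: l, y :: m => if x = y then lcpLength l m + 1 else 0
  | [], _ => 0
  | _, [] => 0

theorem lcpLength_comm : ∀ l m : List β, lcpLength l m = lcpLength m l
  | x :: l, y :: m => by simp only [lcpLength, lcpLength_comm l m, eq_comm]
  | [], [] => rfl
  | [], _ :: _ => rfl
  | _ :: _, [] => rfl

theorem min_le_lcpLength :
    ∀ l m n : List β, min (lcpLength l m) (lcpLength m n) ≤ lcpLength l n
  | x :: l, y :: m, z :: n => by
    have := min_le_lcpLength l m n
    simp only [lcpLength]
    split_ifs <;> simp_all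
  | [], _, _ => by simp [lcpLength]
  | _ :: _, [], _ => by simp [lcpLength]
  | _ :: _, _ :: _, [] => by simp [lcpLength]

end LcpLength

section GromovProduct

variable {α : Type*} [DecidableEq α]

theorem norm_inv_mk_mul_mk_add : ∀ {L M : List (α × Bool)}, IsReduced L → IsReduced M →
    ((mk L)⁻¹ * mk M).norm + 2 * lcpLength L M = L.length + M.length
  | [], M, _, hM => by
    rw [← one_eq_mk, inv_one, one_mul, FreeGroup.norm, toWord_mk_of_isReduced hM]
    simp [lcpLength]
  | x :: L, [], hL, _ => by
    rw [← one_eq_mk, mul_one, norm_inv_eq, FreeGroup.norm, toWord_mk_of_isReduced hL]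
    simp [lcpLength]
  | x :: L, y :: M, hL, hM => by
    by_cases hxy : x = y
    · subst hxy
      have ih := norm_inv_mk_mul_mk_add (L := L) (M := M) (hL.infix ⟨[x], [], by simp⟩)
        (hM.infix ⟨[x], [], by simp⟩)
      have hcancel : (mk (x :: L))⁻¹ * mk (x :: M) = (mk L)⁻¹ * mk M := by
        rw [← List.singleton_append, ← mul_mk, ← List.singleton_append (l := M), ← mul_mk]
        group
      rw [hcancel]
      simp only [lcpLength, if_true, List.length_cons]
      omega
    · have hred : IsReduced (invRev (x :: L) ++ y :: M) := by
        refine isReduced_append_iff.2 ⟨isReduced_invRev hL, hM, fun z hz hz' => ?_⟩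
        have hz : (x.1, !x.2) = z := by simpa [invRev] using hz
        have hz' : y = (z.1, !z.2) := by simpa using hz'
        exact hxy (by rw [hz', ← hz, Bool.not_not])
      rw [inv_mk, mul_mk, FreeGroup.norm, toWord_mk_of_isReduced hred]
      simp [lcpLength, hxy]

/-- The Gromov product of `x` and `y` based at `1` in the Cayley tree: the length of the longest
common prefix of their reduced words. -/
def gromovProduct (x y : FreeGroup α) : ℕ := lcpLength x.toWord y.toWord

theorem gromovProduct_comm (x y : FreeGroup α) : gromovProduct x y = gromovProduct y x :=
  lcpLength_comm _ _

theorem min_le_gromovProduct (x y z : FreeGroup α) :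
    min (gromovProduct x y) (gromovProduct y z) ≤ gromovProduct x z :=
  min_le_lcpLength _ _ _

theorem norm_inv_mul_add (x y : FreeGroup α) :
    (x⁻¹ * y).norm + 2 * gromovProduct x y = x.norm + y.norm := by
  have := norm_inv_mk_mul_mk_add (isReduced_toWord (x := x)) (isReduced_toWord (x := y))
  rwa [mk_toWord, mk_toWord] at this

theorem norm_mul_add (x y : FreeGroup α) :
    (x * y).norm + 2 * gromovProduct x⁻¹ y = x.norm + y.norm := by
  have := norm_inv_mul_add x⁻¹ y
  rwa [inv_inv, norm_inv_eq] at this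

theorem gromovProduct_self_mul_add (x y : FreeGroup α) :
    gromovProduct x (x * y) + gromovProduct x⁻¹ y = x.norm := by
  have hinv := norm_inv_mul_add x (x * y)
  rw [inv_mul_cancel_left] at hinv
  have hmul := norm_mul_add x y
  omega

theorem gromovProduct_le_norm (x y : FreeGroup α) : gromovProduct x y ≤ y.norm := by
  have hinv := norm_inv_mul_add x y
  have hle := norm_mul_le y (y⁻¹ * x)
  rw [mul_inv_cancel_left, ← norm_inv_eq (x := y⁻¹ * x), mul_inv_rev, inv_inv] at hle
  omega

theorem norm_lt_norm_mul_self {x : FreeGroup α} (hx : x ≠ 1) : x.norm < (x * x).norm := by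
  have hsq := congrArg List.length (reduceCyclically.reduce_flatten_replicate_succ
    (isReduced_toWord (x := x)) 1)
  rw [one_add_one_eq_two, ← toWord_pow, pow_two] at hsq
  have hconj := reduceCyclically.conj_conjugator_reduceCyclically x.toWord
  have hcore : (reduceCyclically x.toWord).length ≠ 0 := by
    intro hnil
    rw [List.length_eq_zero_iff.1 hnil, List.append_nil] at hconj
    apply hx
    rw [← mk_toWord (x := x), ← hconj, ← mul_mk, ← inv_mk, mul_inv_cancel]
  have hlen := congrArg List.length hconj
  simp only [List.replicate, List.flatten_cons, List.flatten_nil, List.length_append,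
    invRev_length, List.append_nil] at hsq hlen
  unfold FreeGroup.norm
  omega

theorem two_mul_gromovProduct_inv_self_lt {x : FreeGroup α} (hx : x ≠ 1) :
    2 * gromovProduct x⁻¹ x < x.norm := by
  have hmul := norm_mul_add x x
  have hlt := norm_lt_norm_mul_self hx
  omega

theorem exists_mul_eq_of_le_norm {x : FreeGroup α} {m : ℕ} (hm : m ≤ x.norm) :
    ∃ p q, p * q = x ∧ p.norm = m ∧ m + q.norm = x.norm := by
  refine ⟨mk (x.toWord.take m), mk (x.toWord.drop m), ?_, ?_, ?_⟩
  · rw [mul_mk, List.take_append_drop, mk_toWord]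
  · rw [FreeGroup.norm, toWord_mk_of_isReduced
      (isReduced_toWord.infix (List.take_prefix _ _).isInfix), List.length_take_of_le hm]
  · rw [FreeGroup.norm, toWord_mk_of_isReduced
      (isReduced_toWord.infix (List.drop_suffix _ _).isInfix), List.length_drop]
    exact add_tsub_cancel_of_le hm

/-- If `u` cancels the second half of `v` on one side and the first half on the other, then
conjugating by the first half of `v` shortens `u * v`. -/
theorem exists_mul_eq_of_two_mul_gromovProduct_eq {u v : FreeGroup α}
    (huv : 2 * gromovProduct u⁻¹ v = v.norm) (hvu : 2 * gromovProduct v⁻¹ u = v.norm)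
    (hle : v.norm ≤ u.norm) :
    ∃ p q, p * q = v ∧ (q * p).norm ≤ v.norm ∧ (q * u * p).norm + v.norm ≤ u.norm := by
  set m := gromovProduct u⁻¹ v
  obtain ⟨p, q, hpq, hp, hq⟩ := exists_mul_eq_of_le_norm (x := v) (m := m) (by omega)
  refine ⟨p, q, hpq, by have := norm_mul_le q p; omega, ?_⟩
  have hup : m ≤ gromovProduct u⁻¹ p := by
    have hvp := norm_inv_mul_add p v
    rw [← hpq, inv_mul_cancel_left, hpq, gromovProduct_comm] at hvp
    have := min_le_gromovProduct u⁻¹ v p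
    omega
  have hqu : m ≤ gromovProduct q⁻¹ u := by
    have hqv := norm_inv_mul_add q⁻¹ v⁻¹
    rw [← hpq, mul_inv_rev, inv_mul_cancel_left, ← mul_inv_rev, hpq] at hqv
    simp only [norm_inv_eq] at hqv
    have := min_le_gromovProduct q⁻¹ v⁻¹ u
    omega
  have hu_up := gromovProduct_self_mul_add u p
  have hq_up := min_le_gromovProduct q⁻¹ u (u * p)
  have hnorm_up := norm_mul_add u p
  have hnorm_qup := norm_mul_add q (u * p)
  rw [← mul_assoc] at hnorm_qup
  have hp_le := gromovProduct_le_norm u⁻¹ p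
  omega

end GromovProduct

end CyclicWord

namespace F2

open FreeGroup hiding map_mul map_one map_inv
open CyclicWord

/-- Nielsen's condition: in the product of three letters that do not cancel, the images of the outer
letters do not cancel the image of the middle one. -/
def IsNielsen (θ : MulAut F2) : Prop :=
  ∀ x y z : Fin 2 × Bool, Compatible x y → Compatible y z →
    gromovProduct (θ (mk [x]))⁻¹ (θ (mk [y])) + gromovProduct (θ (mk [y]))⁻¹ (θ (mk [z])) <
      (θ (mk [y])).norm

theorem IsNielsen.length_add_le {θ : MulAut F2} (hθ : IsNielsen θ) (L : List (Fin 2 × Bool))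
    (x : Fin 2 × Bool) (hL : IsReduced (x :: L)) (y : Fin 2 × Bool) (hyx : Compatible y x) :
    gromovProduct (θ (mk [y]))⁻¹ (θ (mk (x :: L))) = gromovProduct (θ (mk [y]))⁻¹ (θ (mk [x])) ∧
      (x :: L).length + gromovProduct (θ (mk [y]))⁻¹ (θ (mk [x])) ≤ (θ (mk (x :: L))).norm := by
  induction L generalizing x y with
  | nil =>
    have := hθ y x x hyx (fun _ => rfl)
    refine ⟨rfl, ?_⟩
    simp only [List.length_cons, List.length_nil]
    omega
  | cons z l ih =>
    rw [isReduced_cons_cons] at hL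
    obtain ⟨hprod, hlen⟩ := ih z hL.2 x hL.1
    have hxyz := hθ y x z hyx hL.1
    have hsplit : θ (mk (x :: z :: l)) = θ (mk [x]) * θ (mk (z :: l)) := by
      rw [← map_mul, mul_mk]; rfl
    rw [hsplit]
    have hnorm := norm_mul_add (θ (mk [x])) (θ (mk (z :: l)))
    have hself := gromovProduct_self_mul_add (θ (mk [x])) (θ (mk (z :: l)))
    have hle := min_le_gromovProduct (θ (mk [y]))⁻¹ (θ (mk [x])) (θ (mk [x]) * θ (mk (z :: l)))
    have hge := min_le_gromovProduct (θ (mk [y]))⁻¹ (θ (mk [x]) * θ (mk (z :: l))) (θ (mk [x]))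
    rw [gromovProduct_comm _ (θ (mk [x]))] at hge
    simp only [List.length_cons] at hlen ⊢
    omega

theorem IsNielsen.norm_le_norm_apply {θ : MulAut F2} (hθ : IsNielsen θ) (g : F2) :
    g.norm ≤ (θ g).norm := by
  rcases hg : g.toWord with _ | ⟨x, L⟩
  · simp [FreeGroup.norm, hg]
  · have hlen := (hθ.length_add_le L x (hg ▸ isReduced_toWord) x fun _ => rfl).2
    rw [← hg, mk_toWord] at hlen
    exact (Nat.le_add_right _ _).trans hlen

theorem IsNielsen.isPermutation_inv {θ : MulAut F2} (hθ : IsNielsen θ) : IsPermutation θ⁻¹ := by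
  refine isPermutation_of_mapsTo fun g hg => ?_
  rw [mem_letters_iff_norm_eq_one] at hg ⊢
  have hle := hθ.norm_le_norm_apply (θ⁻¹ g)
  rw [MulAut.apply_inv_self, hg] at hle
  refine le_antisymm hle (Nat.one_le_iff_ne_zero.2 fun hzero => ?_)
  rw [FreeGroup.norm_eq_zero, MulEquiv.map_eq_one_iff] at hzero
  simp [hzero] at hg

/-- The subgroup of `Aut F₂` generated by `J` and the one-letter automorphisms. -/
def elementary : Subgroup (MulAut F2) := Subgroup.closure (insert shearB J)

theorem shearB_mem_elementary : shearB ∈ elementary :=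
  Subgroup.subset_closure (Set.mem_insert _ _)

theorem mem_elementary_of_mem_J {φ : MulAut F2} (h : φ ∈ J) : φ ∈ elementary :=
  Subgroup.subset_closure (Set.mem_insert_of_mem _ h)

/-- The basis `θ a`, `θ b` cannot be shortened by precomposing `θ` with an elementary
automorphism. -/
def IsShortest (θ : MulAut F2) : Prop :=
  ∀ ψ ∈ elementary, (θ a).norm + (θ b).norm ≤ (θ (ψ a)).norm + (θ (ψ b)).norm

theorem mk_singleton_not (x : Fin 2 × Bool) : mk [(x.1, !x.2)] = (mk [x])⁻¹ := by simp [invRev]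

theorem apply_mk_singleton_ne_one (θ : MulAut F2) (x : Fin 2 × Bool) : θ (mk [x]) ≠ 1 := by
  rw [Ne, MulEquiv.map_eq_one_iff, ← FreeGroup.norm_eq_zero,
    mem_letters_iff_norm_eq_one.1 (mk_mem_letters x)]
  exact one_ne_zero

theorem norm_apply_mk_singleton (θ : MulAut F2) (x : Fin 2 × Bool) :
    (θ (mk [x])).norm = (θ (mk [(x.1, true)])).norm := by
  obtain ⟨i, s⟩ := x
  cases s
  · rw [show ((i, false) : Fin 2 × Bool) = ((i, true).1, !(i, true).2) from rfl,
      mk_singleton_not, map_inv, norm_inv_eq]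
  · rfl

theorem norm_apply_add_norm_apply (θ : MulAut F2) {x y : Fin 2 × Bool} (h : x.1 ≠ y.1) :
    (θ (mk [x])).norm + (θ (mk [y])).norm = (θ a).norm + (θ b).norm := by
  rw [norm_apply_mk_singleton, norm_apply_mk_singleton θ y]
  have hxy : x.1 = 0 ∧ y.1 = 1 ∨ x.1 = 1 ∧ y.1 = 0 := by omega
  rcases hxy with ⟨hx, hy⟩ | ⟨hx, hy⟩ <;> rw [hx, hy]
  · rfl
  · exact add_comm _ _

namespace IsShortest

variable {θ : MulAut F2} {x y : Fin 2 × Bool}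

theorem norm_le_norm_mul (hθ : IsShortest θ) (h : x.1 ≠ y.1) :
    (θ (mk [x])).norm ≤ (θ (mk [x]) * θ (mk [y])).norm := by
  obtain ⟨π, hπ, hπa, hπb⟩ := exists_permutation_apply_eq h.symm
  have hle := hθ (π * shearB) (mul_mem (mem_elementary_of_mem_J hπ.mem_J) shearB_mem_elementary)
  rw [← norm_apply_add_norm_apply θ h] at hle
  simp only [MulAut.mul_apply, shearB_a, shearB_b, map_mul, hπa, hπb] at hle
  omega

theorem two_mul_gromovProduct_le_left (hθ : IsShortest θ) (h : x.1 ≠ y.1) :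
    2 * gromovProduct (θ (mk [x]))⁻¹ (θ (mk [y])) ≤ (θ (mk [x])).norm := by
  have hle := hθ.norm_le_norm_mul (x := (y.1, !y.2)) (y := (x.1, !x.2)) h.symm
  simp only [mk_singleton_not, map_inv, ← mul_inv_rev, norm_inv_eq] at hle
  have := norm_mul_add (θ (mk [x])) (θ (mk [y]))
  omega

theorem two_mul_gromovProduct_le_right (hθ : IsShortest θ) (h : x.1 ≠ y.1) :
    2 * gromovProduct (θ (mk [x]))⁻¹ (θ (mk [y])) ≤ (θ (mk [y])).norm := by
  have hle := hθ.norm_le_norm_mul h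
  have := norm_mul_add (θ (mk [x])) (θ (mk [y]))
  omega

theorem not_half_cancel (hθ : IsShortest θ) (h : x.1 ≠ y.1)
    (hxy : 2 * gromovProduct (θ (mk [x]))⁻¹ (θ (mk [y])) = (θ (mk [y])).norm)
    (hyx : 2 * gromovProduct (θ (mk [y]))⁻¹ (θ (mk [x])) = (θ (mk [y])).norm) : False := by
  obtain ⟨p, q, hpq, hqp, hqup⟩ := exists_mul_eq_of_two_mul_gromovProduct_eq hxy hyx
    (hxy ▸ hθ.two_mul_gromovProduct_le_left h)
  obtain ⟨π, hπ, hπa, hπb⟩ := exists_permutation_apply_eq h.symm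
  obtain ⟨k, hk⟩ := θ.surjective q
  have hle := hθ (MulAut.conj k * (π * shearB)) (mul_mem
    (mem_elementary_of_mem_J (mem_J_of_mem_Inn (conj_mem_Inn _)))
    (mul_mem (mem_elementary_of_mem_J hπ.mem_J) shearB_mem_elementary))
  have hconj_y : q * θ (mk [y]) * q⁻¹ = q * p := by rw [← hpq]; group
  have hconj_yx : q * θ (mk [x]) * q⁻¹ * (q * p) = q * θ (mk [x]) * p := by group
  simp only [MulAut.mul_apply, MulAut.conj_apply, shearB_a, shearB_b, map_mul, hπa, hπb, map_inv,
    hk, hconj_y, hconj_yx] at hle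
  rw [← norm_apply_add_norm_apply θ h] at hle
  have hpos := Nat.pos_of_ne_zero (mt FreeGroup.norm_eq_zero.1 (apply_mk_singleton_ne_one θ y))
  omega

theorem isNielsen (hθ : IsShortest θ) : IsNielsen θ := by
  intro x y z hxy hyz
  have hself := two_mul_gromovProduct_inv_self_lt (apply_mk_singleton_ne_one θ y)
  by_cases hx : x.1 = y.1
  · obtain rfl : x = y := Prod.ext hx (hxy hx)
    by_cases hz : x.1 = z.1
    · obtain rfl : x = z := Prod.ext hz (hyz hz)
      omega
    · have := hθ.two_mul_gromovProduct_le_left hz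
      omega
  by_cases hz : y.1 = z.1
  · obtain rfl : y = z := Prod.ext hz (hyz hz)
    have := hθ.two_mul_gromovProduct_le_right hx
    omega
  have hle_x := hθ.two_mul_gromovProduct_le_right hx
  have hle_z := hθ.two_mul_gromovProduct_le_left hz
  by_contra hcancel
  have hxz : x.1 = z.1 := by omega
  obtain hxz | hxz : z = x ∨ z = (x.1, !x.2) := by
    rcases eq_or_ne z.2 x.2 with hsign | hsign
    · exact Or.inl (Prod.ext hxz.symm hsign)
    · exact Or.inr (Prod.ext hxz.symm (Bool.eq_not.2 hsign))
  · rw [hxz] at hle_z hcancel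
    exact hθ.not_half_cancel hx (by omega) (by omega)
  · rw [hxz, mk_singleton_not, map_inv] at hle_z hcancel
    have := min_le_gromovProduct (θ (mk [y]))⁻¹ (θ (mk [x]))⁻¹ (θ (mk [y]))
    omega

end IsShortest

/-- Nielsen's theorem: the images of `a` and `b` are shortened by elementary automorphisms until
they are letters. -/
theorem elementary_eq_top : elementary = ⊤ := by
  rw [Subgroup.eq_top_iff']
  intro φ
  obtain ⟨ψ, hψ⟩ := exists_minimalFor_of_wellFoundedLT (· ∈ elementary)
    (fun ψ => (φ (ψ a)).norm + (φ (ψ b)).norm) ⟨1, one_mem _⟩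
  have hshort : IsShortest (φ * ψ) := fun χ hχ =>
    (le_total _ _).elim id (hψ.2 (mul_mem hψ.1 hχ))
  have hmem := mem_elementary_of_mem_J (J.inv_mem hshort.isNielsen.isPermutation_inv.mem_J)
  rw [inv_inv] at hmem
  simpa using mul_mem hmem (inv_mem hψ.1)

/-- The products of the automorphisms `shearB` and `shearA`. -/
inductive IsPositive : MulAut F2 → Prop
  | one : IsPositive 1
  | shearB_mul {φ : MulAut F2} : IsPositive φ → IsPositive (shearB * φ)
  | shearA_mul {φ : MulAut F2} : IsPositive φ → IsPositive (shearA * φ)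

/-- The automorphisms that agree modulo inner automorphisms with `j * χ * j'` for some positive `χ`
and some `j`, `j'` in `J`. -/
def IsFactored (φ : MulAut F2) : Prop :=
  ∃ j ∈ J, ∃ χ, IsPositive χ ∧ ∃ j' ∈ J, out φ = out (j * χ * j')

theorem IsFactored.congr {φ ψ : MulAut F2} (h : IsFactored φ) (hψφ : out ψ = out φ) :
    IsFactored ψ := by
  obtain ⟨j, hj, χ, hχ, j', hj', hφ⟩ := h
  exact ⟨j, hj, χ, hχ, j', hj', hψφ.trans hφ⟩

theorem IsFactored.J_mul {φ ψ : MulAut F2} (h : IsFactored φ) (hψ : ψ ∈ J) :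
    IsFactored (ψ * φ) := by
  obtain ⟨j, hj, χ, hχ, j', hj', hφ⟩ := h
  exact ⟨ψ * j, J.mul_mem hψ hj, χ, hχ, j', hj', by simp only [map_mul, hφ, mul_assoc]⟩

theorem IsPositive.isFactored_mul {χ j' : MulAut F2} (hχ : IsPositive χ) (hj' : j' ∈ J) :
    IsFactored (χ * j') :=
  ⟨1, J.one_mem, χ, hχ, j', hj', by rw [one_mul]⟩

theorem isFactored_shearB_inv_mul {χ j' : MulAut F2} (hχ : IsPositive χ) (hj' : j' ∈ J) :
    IsFactored (shearB⁻¹ * χ * j') := by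
  cases hχ with
  | one =>
    refine ((IsPositive.one.shearB_mul.isFactored_mul (J.mul_mem flip_mem_J hj')).J_mul
      flip_mem_J).congr ?_
    have hrel := out_flip_mul_shearB
    have hflip := congrArg out flip_mul_flip
    simp only [map_mul, map_one, mul_one] at hrel hflip ⊢
    rw [← mul_assoc (out flip), hrel, mul_assoc, ← mul_assoc (out flip), hflip, one_mul]
  | shearB_mul h =>
    rw [inv_mul_cancel_left]
    exact h.isFactored_mul hj'
  | @shearA_mul φ h =>
    refine ((h.shearB_mul.isFactored_mul hj').J_mul (J.mul_mem swap_mem_J flip_mem_J)).congr ?_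
    have hrel := out_shearB_inv_mul_shearA
    simp only [map_mul] at hrel ⊢
    rw [← mul_assoc, hrel]
    simp only [mul_assoc]

theorem IsPositive.exists_swap_mul_eq {χ : MulAut F2} (hχ : IsPositive χ) :
    ∃ χ', IsPositive χ' ∧ swap * χ = χ' * swap := by
  induction hχ with
  | one => exact ⟨1, .one, rfl⟩
  | shearB_mul _ ih =>
    obtain ⟨χ', hχ', hswap⟩ := ih
    exact ⟨shearA * χ', hχ'.shearA_mul, by
      rw [← mul_assoc, swap_mul_shearB, mul_assoc, hswap, mul_assoc]⟩
  | shearA_mul _ ih =>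
    obtain ⟨χ', hχ', hswap⟩ := ih
    exact ⟨shearB * χ', hχ'.shearB_mul, by
      rw [← mul_assoc, swap_mul_shearA, mul_assoc, hswap, mul_assoc]⟩

theorem isFactored_shearA_inv_mul {χ j' : MulAut F2} (hχ : IsPositive χ) (hj' : j' ∈ J) :
    IsFactored (shearA⁻¹ * χ * j') := by
  obtain ⟨χ', hχ', hswap⟩ := hχ.exists_swap_mul_eq
  have h := (isFactored_shearB_inv_mul hχ' (J.mul_mem swap_mem_J hj')).J_mul swap_mem_J
  convert h using 1
  rw [shearA_inv, mul_assoc _ swap χ, hswap]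
  simp only [mul_assoc]

theorem isFactored_move_mul {χ j' : MulAut F2} (hχ : IsPositive χ) (hj' : j' ∈ J) :
    ∀ i, IsFactored (move i * χ * j')
  | 0 => hχ.shearB_mul.isFactored_mul hj'
  | 1 => hχ.shearA_mul.isFactored_mul hj'
  | 2 => isFactored_shearB_inv_mul hχ hj'
  | 3 => isFactored_shearA_inv_mul hχ hj'

theorem IsFactored.move_mul {φ : MulAut F2} (h : IsFactored φ) (i : Fin 4) :
    IsFactored (move i * φ) := by
  obtain ⟨j, hj, χ, hχ, j', hj', hφ⟩ := h
  obtain ⟨k, hk⟩ := exists_move_mul_eq hj i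
  refine ((isFactored_move_mul hχ hj' k).J_mul hj).congr ?_
  simp only [map_mul] at hk hφ ⊢
  rw [hφ, ← mul_assoc, ← mul_assoc, hk]
  simp only [mul_assoc]

theorem isFactored (φ : MulAut F2) : IsFactored φ := by
  have hφ : φ ∈ elementary := elementary_eq_top ▸ Subgroup.mem_top φ
  unfold elementary at hφ
  induction hφ using Subgroup.closure_induction_left with
  | one => exact ⟨1, J.one_mem, 1, .one, 1, J.one_mem, rfl⟩
  | mul_left x hx y _ ih =>
    rcases hx with rfl | hx
    · exact ih.move_mul 0
    · exact ih.J_mul hx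
  | inv_mul_cancel x hx y _ ih =>
    rcases hx with rfl | hx
    · exact ih.move_mul 2
    · exact ih.J_mul (J.inv_mem hx)

/-! ### Minimal words and level tables -/

theorem turns_shearB (g : F2) :
    turns (shearB g) = squares 1 (shearB g) + squares 1 g + turns g := by
  have hinv := cycNorm_shearB_inv (shearB g)
  rw [MulAut.inv_apply_self, cycNorm_shearB] at hinv
  omega

theorem turns_shearA (g : F2) :
    turns (shearA g) = squares 0 (shearA g) + squares 0 g + turns g := by
  have hinv := cycNorm_shearA_inv (shearA g)
  rw [MulAut.inv_apply_self, cycNorm_shearA] at hinv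
  omega

theorem turns_shearB_inv (g : F2) :
    turns (shearB⁻¹ g) = turns g - squares 1 g - squares 1 (shearB⁻¹ g) := by
  have hinv := cycNorm_shearB (shearB⁻¹ g)
  rw [MulAut.apply_inv_self, cycNorm_shearB_inv] at hinv
  omega

theorem turns_shearA_inv (g : F2) :
    turns (shearA⁻¹ g) = turns g - squares 0 g - squares 0 (shearA⁻¹ g) := by
  have hinv := cycNorm_shearA (shearA⁻¹ g)
  rw [MulAut.apply_inv_self, cycNorm_shearA_inv] at hinv
  omega

theorem squares_zero_shearB (g : F2) :
    squares 0 (shearB g) = turns (shearB g) + squares 0 g - squares 1 g := by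
  have hJ := congrArg ((↑) : ℕ → ℤ) (cycNorm_congr_J (jEquiv_shearA_inv_shearB g))
  rw [cycNorm_shearA_inv, cycNorm_shearB, cycNorm_shearA] at hJ
  omega

theorem squares_one_shearA (g : F2) :
    squares 1 (shearA g) = turns (shearA g) + squares 1 g - squares 0 g := by
  have hJ := congrArg ((↑) : ℕ → ℤ) (cycNorm_congr_J (jEquiv_shearB_inv_shearA g))
  rw [cycNorm_shearB_inv, cycNorm_shearA, cycNorm_shearB] at hJ
  omega

theorem squares_zero_shearB_inv (g : F2) :
    squares 0 (shearB⁻¹ g) = -turns (shearB⁻¹ g) + squares 0 g - squares 1 g := by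
  have hJ := congrArg ((↑) : ℕ → ℤ) (cycNorm_congr_J (jEquiv_shearA_shearB_inv g))
  rw [cycNorm_shearA, cycNorm_shearB_inv, cycNorm_shearA_inv] at hJ
  omega

theorem squares_one_shearA_inv (g : F2) :
    squares 1 (shearA⁻¹ g) = -turns (shearA⁻¹ g) + squares 1 g - squares 0 g := by
  have hJ := congrArg ((↑) : ℕ → ℤ) (cycNorm_congr_J (jEquiv_shearB_shearA_inv g))
  rw [cycNorm_shearB, cycNorm_shearA_inv, cycNorm_shearB_inv] at hJ
  omega

/-- The cyclic word of `g` contains neither `aa` nor `bb` nor their inverses; unlike being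
alternating, this does not require `g` itself to be cyclically reduced. -/
def SquareFree (g : F2) : Prop := squares 0 g = 0 ∧ squares 1 g = 0

theorem squareFree_congr {x y : F2} (h : JEquiv x y) : SquareFree x ↔ SquareFree y := by
  refine Eq.to_iff (h.congr_of_invariant (fun x y h => ?_) (fun x => ?_) fun x => ?_)
  · simp only [SquareFree, squares_congr _ h]
  · simp only [SquareFree, squares_flip]
  · simp only [SquareFree, squares_swap]
    exact propext and_comm

/-- No one-letter automorphism makes the cyclic word of `g` shorter. -/
def IsLocallyMinimal (g : F2) : Prop := ∀ i, cycNorm g ≤ cycNorm (move i g)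

theorem IsLocallyMinimal.congr {x y : F2} (hx : IsLocallyMinimal x) (h : JEquiv x y) :
    IsLocallyMinimal y := fun i => by
  obtain ⟨k, hk⟩ := h.symm.exists_move i
  rw [cycNorm_congr_J hk, ← cycNorm_congr_J h]
  exact hx k

theorem IsLocallyMinimal.squares_one_add_turns_nonneg {g : F2} (hg : IsLocallyMinimal g) :
    0 ≤ squares 1 g + turns g := by
  have hle := hg 0
  have hshear := cycNorm_shearB g
  rw [move_zero] at hle
  omega

theorem IsLocallyMinimal.squares_zero_add_turns_nonneg {g : F2} (hg : IsLocallyMinimal g) :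
    0 ≤ squares 0 g + turns g := by
  have hle := hg 1
  have hshear := cycNorm_shearA g
  rw [move_one] at hle
  omega

-- The two inequalities on `squares` and `turns` say that the positive one-letter automorphisms do
-- not shorten the cyclic word; they persist because `squares` is nonnegative.
theorem IsPositive.cycNorm_le {χ : MulAut F2} (hχ : IsPositive χ) {g : F2}
    (h0 : 0 ≤ squares 0 g + turns g) (h1 : 0 ≤ squares 1 g + turns g) :
    cycNorm g ≤ cycNorm (χ g) ∧ 0 ≤ squares 0 (χ g) + turns (χ g) ∧
      0 ≤ squares 1 (χ g) + turns (χ g) := by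
  induction hχ with
  | one => exact ⟨le_rfl, h0, h1⟩
  | @shearB_mul φ _ ih =>
    have hlen := cycNorm_shearB (φ g)
    have hturns := turns_shearB (φ g)
    have hsq := squares_nonneg 0 (shearB (φ g))
    have hsq' := squares_nonneg 1 (shearB (φ g))
    rw [MulAut.mul_apply]
    omega
  | @shearA_mul φ _ ih =>
    have hlen := cycNorm_shearA (φ g)
    have hturns := turns_shearA (φ g)
    have hsq := squares_nonneg 0 (shearA (φ g))
    have hsq' := squares_nonneg 1 (shearA (φ g))
    rw [MulAut.mul_apply]
    omega

theorem IsPositive.apply_mem {χ : MulAut F2} (hχ : IsPositive χ) {S : Set F2}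
    (hS : ∀ x ∈ S, ∀ i, cycNorm (move i x) = cycNorm x → move i x ∈ S) {g : F2} (hg : g ∈ S)
    (hmin : IsLocallyMinimal g) (h : cycNorm (χ g) = cycNorm g) : χ g ∈ S := by
  have h0 := hmin.squares_zero_add_turns_nonneg
  have h1 := hmin.squares_one_add_turns_nonneg
  induction hχ with
  | one => exact hg
  | @shearB_mul φ hφ ih =>
    have hle := hφ.cycNorm_le h0 h1
    have hlen := cycNorm_shearB (φ g)
    rw [MulAut.mul_apply] at h ⊢
    exact hS _ (ih (by omega)) 0 (by rw [move_zero]; omega)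
  | @shearA_mul φ hφ ih =>
    have hle := hφ.cycNorm_le h0 h1
    have hlen := cycNorm_shearA (φ g)
    rw [MulAut.mul_apply] at h ⊢
    exact hS _ (ih (by omega)) 1 (by rw [move_one]; omega)

theorem IsLocallyMinimal.cycNorm_le_apply {g : F2} (hmin : IsLocallyMinimal g) (φ : MulAut F2) :
    cycNorm g ≤ cycNorm (φ g) := by
  obtain ⟨j, hj, χ, hχ, j', hj', hφ⟩ := isFactored φ
  have hmin' := hmin.congr (jEquiv_apply hj' g)
  rw [cycNorm_congr_J (JEquiv.of_out_eq hφ g), MulAut.mul_apply, MulAut.mul_apply,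
    ← cycNorm_congr_J (jEquiv_apply hj _), cycNorm_congr_J (jEquiv_apply hj' g)]
  exact (hχ.cycNorm_le hmin'.squares_zero_add_turns_nonneg
    hmin'.squares_one_add_turns_nonneg).1

theorem IsLocallyMinimal.apply_mem {S : Set F2} (hJ : ∀ x ∈ S, ∀ y, JEquiv x y → y ∈ S)
    (hS : ∀ x ∈ S, ∀ i, cycNorm (move i x) = cycNorm x → move i x ∈ S) {g : F2}
    (hmin : IsLocallyMinimal g) (hg : g ∈ S) {φ : MulAut F2} (h : cycNorm (φ g) = cycNorm g) :
    φ g ∈ S := by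
  obtain ⟨j, hj, χ, hχ, j', hj', hφ⟩ := isFactored φ
  have hleft : JEquiv (χ (j' g)) (φ g) := (jEquiv_apply hj _).trans (JEquiv.of_out_eq hφ g).symm
  have hright := jEquiv_apply hj' g
  rw [← cycNorm_congr_J hleft, cycNorm_congr_J hright] at h
  exact hJ _ (hχ.apply_mem hS (hJ g hg _ hright) (hmin.congr hright) h) _ hleft

theorem apply_mem_of_isAutClass {W : Set F2} (hW : IsAutClass W) {x : F2} (hx : x ∈ W)
    (φ : MulAut F2) : φ x ∈ W := by
  obtain ⟨w, rfl⟩ := hW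
  obtain ⟨ψ, rfl⟩ := hx
  exact ⟨φ * ψ, rfl⟩

theorem exists_aut_of_mem {W : Set F2} (hW : IsAutClass W) {x y : F2} (hx : x ∈ W)
    (hy : y ∈ W) : ∃ φ : MulAut F2, φ x = y := by
  obtain ⟨w, rfl⟩ := hW
  obtain ⟨ψ, rfl⟩ := hx
  obtain ⟨χ, rfl⟩ := hy
  exact ⟨χ * ψ⁻¹, by rw [MulAut.mul_apply, MulAut.inv_apply_self]⟩

theorem mk_cycWord_mem {W : Set F2} (hW : IsAutClass W) {x : F2} (hx : x ∈ W) :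
    FreeGroup.mk (cycWord x) ∈ W := by
  obtain ⟨g, hg⟩ := isConj_iff.1 (isConj_mk_cycWord x).symm
  rw [← hg]
  exact apply_mem_of_isAutClass hW hx (MulAut.conj g)

theorem norm_mk_cycWord (g : F2) : (FreeGroup.mk (cycWord g)).norm = cycNorm g := by
  rw [FreeGroup.norm, toWord_mk_of_isReduced (isCyclicallyReduced_cycWord g).isReduced, cycNorm]

theorem isMinimal_iff {W : Set F2} (hW : IsAutClass W) {x : F2} (hx : x ∈ W)
    (hmin : ∀ φ : MulAut F2, cycNorm x ≤ cycNorm (φ x)) {v : F2} (hv : v ∈ W) :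
    IsMinimal v ↔ v.norm = cycNorm x := by
  have hle (y : F2) (hy : y ∈ W) : cycNorm x ≤ y.norm := by
    obtain ⟨φ, rfl⟩ := exists_aut_of_mem hW hx hy
    exact (hmin φ).trans (cycNorm_le_norm _)
  constructor
  · intro h
    obtain ⟨φ, hφ⟩ := exists_aut_of_mem hW hv (mk_cycWord_mem hW hx)
    refine le_antisymm ?_ (hle v hv)
    simpa only [hφ, norm_mk_cycWord] using h φ
  · intro h φ
    rw [h]
    exact hle _ (apply_mem_of_isAutClass hW hv φ)

theorem IsMinimal.isCyclic {v : F2} (h : IsMinimal v) : IsCyclic v := by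
  refine cycNorm_eq_norm_iff.1 (le_antisymm (cycNorm_le_norm v) ?_)
  obtain ⟨g, hg⟩ := isConj_iff.1 (isConj_mk_cycWord v).symm
  simpa only [MulAut.conj_apply, hg, norm_mk_cycWord] using h (MulAut.conj g)

theorem IsMinimal.cycNorm_eq_norm {v : F2} (h : IsMinimal v) : cycNorm v = v.norm :=
  cycNorm_eq_norm_iff.2 h.isCyclic

/-- A description of the length-preserving one-letter automorphisms on finitely many classes: the
elements `u i` are of cyclic length `m`, and `move k` maps `u i` to an element equivalent to `u t`
if `tgt i k = some t`, and to a longer one if `tgt i k = none`. -/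
structure IsLevelTable {n : ℕ} (u : Fin n → F2) (tgt : Fin n → Fin 4 → Option (Fin n))
    (m : ℕ) : Prop where
  cycNorm_eq : ∀ i, cycNorm (u i) = m
  equiv_of_some : ∀ i k t, tgt i k = some t → JEquiv (move k (u i)) (u t)
  lt_of_none : ∀ i k, tgt i k = none → m < cycNorm (move k (u i))

namespace IsLevelTable

variable {n m : ℕ} {u : Fin n → F2} {tgt : Fin n → Fin 4 → Option (Fin n)} {W : Set F2}

theorem isLocallyMinimal (h : IsLevelTable u tgt m) (i : Fin n) : IsLocallyMinimal (u i) := by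
  intro k
  rw [h.cycNorm_eq]
  cases hk : tgt i k with
  | none => exact (h.lt_of_none i k hk).le
  | some t => rw [cycNorm_congr_J (h.equiv_of_some i k t hk), h.cycNorm_eq]

theorem jEquiv_move_iff (h : IsLevelTable u tgt m) (hinj : ∀ i j, JEquiv (u i) (u j) → i = j)
    (i j : Fin n) (k : Fin 4) : JEquiv (move k (u i)) (u j) ↔ tgt i k = some j := by
  cases hk : tgt i k with
  | none =>
    have hlt := h.lt_of_none i k hk
    refine iff_of_false (fun hj => ?_) (by simp)
    rw [cycNorm_congr_J hj, h.cycNorm_eq] at hlt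
    exact lt_irrefl _ hlt
  | some t =>
    have ht := h.equiv_of_some i k t hk
    rw [Option.some_inj]
    exact ⟨fun hj => hinj _ _ (ht.symm.trans hj), fun hj => hj ▸ ht⟩

theorem exists_jEquiv_apply (h : IsLevelTable u tgt m) (i : Fin n) {φ : MulAut F2}
    (hφ : cycNorm (φ (u i)) = m) : ∃ t, JEquiv (φ (u i)) (u t) := by
  refine (h.isLocallyMinimal i).apply_mem (S := {g | ∃ t, JEquiv g (u t)})
    (fun x ⟨t, ht⟩ y hy => ⟨t, hy.symm.trans ht⟩) ?_ ⟨i, JEquiv.refl _⟩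
    (hφ.trans (h.cycNorm_eq i).symm)
  rintro x ⟨t, ht⟩ k hk
  obtain ⟨l, hl⟩ := ht.exists_move k
  rw [cycNorm_congr_J hl, cycNorm_congr_J ht, h.cycNorm_eq] at hk
  cases htl : tgt t l with
  | none => exact absurd hk (h.lt_of_none t l htl).ne'
  | some s => exact ⟨s, hl.trans (h.equiv_of_some t l s htl)⟩

theorem isMinimal_iff (h : IsLevelTable u tgt m) (hW : IsAutClass W) {i : Fin n} (hu : u i ∈ W)
    {v : F2} (hv : v ∈ W) : IsMinimal v ↔ v.norm = m := by
  rw [F2.isMinimal_iff hW hu (h.isLocallyMinimal i).cycNorm_le_apply hv, h.cycNorm_eq]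

theorem exists_minimalWord (h : IsLevelTable u tgt m) (hW : IsAutClass W) {i : Fin n}
    (hu : u i ∈ W) : ∃ r : MinimalWord W, JEquiv r.1 (u i) :=
  ⟨⟨FreeGroup.mk (cycWord (u i)), mk_cycWord_mem hW hu,
    (h.isMinimal_iff hW hu (mk_cycWord_mem hW hu)).2 (by rw [norm_mk_cycWord, h.cycNorm_eq])⟩,
    .of_isConj (isConj_mk_cycWord _)⟩

theorem exists_jEquiv (h : IsLevelTable u tgt m) (hW : IsAutClass W) {i : Fin n} (hu : u i ∈ W)
    (v : MinimalWord W) : ∃ t, JEquiv v.1 (u t) := by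
  obtain ⟨φ, hφ⟩ := exists_aut_of_mem hW hu v.2.1
  have hm := v.2.2.cycNorm_eq_norm
  rw [(h.isMinimal_iff hW hu v.2.1).1 v.2.2, ← hφ] at hm
  rw [← hφ]
  exact h.exists_jEquiv_apply i hm

theorem edgeCount_eq (h : IsLevelTable u tgt m) (hinj : ∀ i j, JEquiv (u i) (u j) → i = j)
    (i j : Fin n) :
    edgeCount (u i) (u j) = (Finset.univ.filter fun k => tgt i k = some j).card := by
  classical
  rw [edgeCount_eq_card]
  simp only [h.jEquiv_move_iff hinj]

theorem card_vertex (h : IsLevelTable u tgt m) (hW : IsAutClass W) (hu : ∀ i, u i ∈ W)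
    (hn : n ≠ 0) : Nat.card (Vertex W) ≠ 0 ∧ Nat.card (Vertex W) ≤ n := by
  choose r hr using fun i => h.exists_minimalWord hW (hu i)
  have : NeZero n := ⟨hn⟩
  have hsurj : Function.Surjective fun i => (Quotient.mk (jSetoid W) (r i) : Vertex W) := by
    rintro ⟨v⟩
    obtain ⟨t, ht⟩ := h.exists_jEquiv hW (hu 0) v
    exact ⟨t, Quotient.sound (s := jSetoid W) ((hr t).trans ht.symm)⟩
  have : Finite (Vertex W) := Finite.of_surjective _ hsurj
  have : Nonempty (Vertex W) := ⟨Quotient.mk (jSetoid W) (r 0)⟩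
  exact ⟨Nat.card_pos.ne',
    (Nat.card_le_card_of_surjective _ hsurj).trans_eq (Nat.card_fin n)⟩

end IsLevelTable

theorem subwordCount_eq_cycSum {u w : F2} {x y x' y' : Fin 2 × Bool} (hu : u.toWord = [x, y])
    (hu' : (u⁻¹).toWord = [x', y']) (hw : IsCyclic w) (h1 : w.norm ≠ 1) :
    (subwordCount u w : ℤ) = cycSum
      (fun s t => if (s = x ∧ t = y) ∨ (s = x' ∧ t = y') then 1 else 0) (cycWord w) := by
  have hcyc : cycWord w = w.toWord := reduceCyclically_eq_self hw
  have hlen : w.toWord.length ≠ 1 := h1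
  rw [hcyc, cycSum, subwordCount, Finset.card_filter, Nat.cast_sum, hu, hu']
  refine Finset.sum_congr rfl fun i hi => ?_
  rw [Finset.mem_range] at hi
  simp only [pair_prefix_rotate_iff (show 2 ≤ w.toWord.length by omega)]
  split_ifs <;> rfl

theorem subwordCount_aa {w : F2} (hw : IsCyclic w) (h1 : w.norm ≠ 1) :
    (subwordCount (a * a) w : ℤ) = squares 0 w := by
  rw [subwordCount_eq_cycSum (x := (0, true)) (y := (0, true)) (x' := (0, false))
    (y' := (0, false)) (by decide) (by decide) hw h1, squares]
  congr 1
  decide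

theorem subwordCount_bb {w : F2} (hw : IsCyclic w) (h1 : w.norm ≠ 1) :
    (subwordCount (b * b) w : ℤ) = squares 1 w := by
  rw [subwordCount_eq_cycSum (x := (1, true)) (y := (1, true)) (x' := (1, false))
    (y' := (1, false)) (by decide) (by decide) hw h1, squares]
  congr 1
  decide

theorem subwordCount_ab_sub {w : F2} (hw : IsCyclic w) (h1 : w.norm ≠ 1) :
    (subwordCount (a * b) w : ℤ) - subwordCount (a * b⁻¹) w = turns w := by
  rw [subwordCount_eq_cycSum (x := (0, true)) (y := (1, true)) (x' := (1, false))
    (y' := (0, false)) (by decide) (by decide) hw h1,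
    subwordCount_eq_cycSum (x := (0, true)) (y := (1, false)) (x' := (1, true))
    (y' := (0, false)) (by decide) (by decide) hw h1, turns, cycSum, cycSum, cycSum,
    ← Finset.sum_sub_distrib]
  refine Finset.sum_congr rfl fun i _ => ?_
  generalize unroll (cycWord w) i = x, unroll (cycWord w) (i + 1) = y
  decide +revert

theorem isAlternating_iff {w : F2} (hw : IsCyclic w) (h1 : w.norm ≠ 1) :
    IsAlternating w ↔ SquareFree w := by
  rw [IsAlternating, SquareFree, ← subwordCount_aa hw h1, ← subwordCount_bb hw h1,
    Nat.cast_eq_zero, Nat.cast_eq_zero, and_iff_right hw]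

/-- Exactly one vertex of `Gamma W` contains an alternating minimal word, and `Gamma W` is
isomorphic to `G` by a map that sends this vertex to `0`. -/
def HasPointedGraph (W : Set F2) {n : ℕ} [NeZero n] (G : MultiDigraph (Fin n)) : Prop :=
  ∃ v₀ : Vertex W, (∀ v : Vertex W, v.HasAlternating ↔ v = v₀) ∧ (Gamma W).PointedIso v₀ G 0

theorem HasPointedGraph.card_vertex {W : Set F2} {n : ℕ} [NeZero n] {G : MultiDigraph (Fin n)}
    (h : HasPointedGraph W G) : Nat.card (Vertex W) = n := by
  obtain ⟨-, -, e, -, -⟩ := h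
  rw [Nat.card_congr e, Nat.card_fin]

theorem IsLevelTable.hasPointedGraph {n m : ℕ} [NeZero n] {u : Fin n → F2}
    {tgt : Fin n → Fin 4 → Option (Fin n)} (h : IsLevelTable u tgt m) {W : Set F2}
    (hW : IsAutClass W) (hu : ∀ i, u i ∈ W) (hinj : ∀ i j, JEquiv (u i) (u j) → i = j)
    (hm : m ≠ 1) (halt : ∀ i, SquareFree (u i) ↔ i = 0) {M : Matrix (Fin n) (Fin n) ℕ}
    (hM : ∀ i j, M i j = (Finset.univ.filter fun k => tgt i k = some j).card) :
    HasPointedGraph W (ofMatrix M) := by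
  choose r hr using fun i => h.exists_minimalWord hW (hu i)
  choose t ht using h.exists_jEquiv hW (hu 0)
  have hwell (v v' : MinimalWord W) (hv : JEquiv v.1 v'.1) : t v = t v' :=
    hinj _ _ ((ht v).symm.trans (hv.trans (ht v')))
  have halt' (v : MinimalWord W) : IsAlternating v.1 ↔ t v = 0 := by
    have hnorm : v.1.norm ≠ 1 := by rwa [(h.isMinimal_iff hW (hu 0) v.2.1).1 v.2.2]
    rw [isAlternating_iff v.2.2.isCyclic hnorm, squareFree_congr (ht v), halt]
  let e : Vertex W ≃ Fin n :=
    { toFun := Quotient.lift t hwell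
      invFun := fun i => Quotient.mk (jSetoid W) (r i)
      left_inv := by
        rintro ⟨v⟩
        exact Quotient.sound (s := jSetoid W) ((hr (t v)).trans (ht v).symm)
      right_inv := fun i => hinj _ _ ((ht (r i)).symm.trans (hr i)) }
  refine ⟨e.symm 0, fun v => ?_, e, e.apply_symm_apply 0, ?_⟩
  · rw [Equiv.eq_symm_apply]
    constructor
    · rintro ⟨w, hw, rfl⟩
      exact (halt' w).1 hw
    · obtain ⟨w⟩ := v
      exact fun hw => ⟨w, (halt' w).2 hw, rfl⟩
  · rintro ⟨v⟩ ⟨v'⟩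
    change edgeCount v.1 v'.1 = M (t v) (t v')
    rw [edgeCount_congr (ht v) (ht v'), h.edgeCount_eq hinj, hM]

end F2

/-! ### Words without squares -/

namespace CyclicWord

theorem isChain_append_self {α : Type*} [Inhabited α] {R : α → α → Prop} {L : List α}
    (h : ∀ i, R (unroll L i) (unroll L (i + 1))) : (L ++ L).IsChain R := by
  have hL : L ++ L = (List.range (L.length + L.length)).map (unroll L) := by
    rw [List.range_add, List.map_append, map_unroll_range, List.map_map]
    congr 1
    conv_lhs => rw [← map_unroll_range L]
    refine List.map_congr_left fun i _ => ?_
    rw [Function.comp_apply, add_comm, unroll_periodic]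
  rw [hL, List.isChain_iff_getElem]
  intro i _
  simpa only [List.getElem_map, List.getElem_range] using h i

theorem sum_range_mul_of_periodic {f : ℕ → ℤ} {m : ℕ} (hf : Function.Periodic f m) (k : ℕ) :
    ∑ i ∈ Finset.range (k * m), f i = k * ∑ i ∈ Finset.range m, f i := by
  induction k with
  | zero => simp
  | succ k ih =>
    have hshift (i : ℕ) : f (k * m + i) = f i := by rw [add_comm]; exact hf.nat_mul k i
    rw [Nat.succ_mul, Finset.sum_range_add, ih, Finset.sum_congr rfl fun i _ => hshift i]
    push_cast
    ring

theorem odd_sum_range_iff {f : ℕ → ℤ} (hf : ∀ i, Odd (f i)) (r : ℕ) :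
    Odd (∑ i ∈ Finset.range r, f i) ↔ Odd r := by
  induction r with
  | zero => simp
  | succ r ih =>
    rw [Finset.sum_range_succ, Int.odd_add', Nat.odd_add_one, ← ih, Int.not_odd_iff_even]
    exact iff_true_left (hf r)

end CyclicWord

namespace F2

open FreeGroup hiding map_mul map_one map_inv
open CyclicWord

section Alternation

variable {e : ℕ → Fin 2 × Bool}

theorem fst_eq_iff_even (he : ∀ i, (e (i + 1)).1 = (e i).1 + 1) (k : ℕ) :
    (e k).1 = (e 0).1 ↔ Even k := by
  induction k with
  | zero => simp
  | succ k ih =>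
    have key : ∀ c d : Fin 2, c + 1 = d ↔ ¬c = d := by decide
    rw [he, Nat.even_add_one, ← ih, key]

theorem chunk_append_chunk : ∀ x y z : Fin 2 × Bool, x.1 = 1 → y.1 = 0 → z.1 = 1 →
    (chunk x y ++ chunk y z ++ [z]).IsChain (fun s t => s.1 ≠ t.1) →
    chunk x y ++ chunk y z = [x, y] := by
  rintro ⟨i, s⟩ ⟨j, t⟩ ⟨k, u⟩ rfl rfl rfl
  cases s <;> cases t <;> cases u <;> simp [chunk]

theorem head?_chunk : ∀ x y : Fin 2 × Bool, x.1 = 1 → (chunk x y).head? = some x := by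
  decide

theorem transduce_eq_map (he : ∀ i, (e (i + 1)).1 = (e i).1 + 1) (h0 : (e 0).1 = 1) (k : ℕ)
    (h : (transduce e (k + k) ++ [e (k + k)]).IsChain fun s t => s.1 ≠ t.1) :
    transduce e (k + k) = (List.range (k + k)).map e := by
  induction k with
  | zero => rfl
  | succ k ih =>
    have hx : (e (k + k)).1 = 1 := ((fst_eq_iff_even he _).2 ⟨k, rfl⟩).trans h0
    have hy : (e (k + k + 1)).1 = 0 := by rw [he, hx]; rfl
    have hz : (e (k + k + 1 + 1)).1 = 1 := by rw [he, hy]; rfl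
    rw [show k + 1 + (k + 1) = k + k + 1 + 1 by omega] at h ⊢
    rw [transduce_succ, transduce_succ, List.append_assoc (transduce e (k + k))] at h ⊢
    have hlast := chunk_append_chunk _ _ _ hx hy hz
      (h.suffix ⟨transduce e (k + k), by simp⟩)
    rw [hlast] at h ⊢
    rw [ih (h.prefix ⟨[e (k + k + 1), e (k + k + 1 + 1)], by simp⟩), List.range_succ,
      List.range_succ]
    simp

end Alternation

theorem fst_unroll_succ {L : List (Fin 2 × Bool)} (hL : IsCyclicallyReduced L) (hne : L ≠ [])
    (hg : SquareFree (FreeGroup.mk L)) (i : ℕ) :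
    (unroll L (i + 1)).1 = (unroll L i).1 + 1 := by
  rw [SquareFree, squares, squares, cycWord_mk hL] at hg
  have h0 := eq_zero_of_cycSum_eq_zero (square_nonneg 0) hne hg.1 i
  have h1 := eq_zero_of_cycSum_eq_zero (square_nonneg 1) hne hg.2 i
  have key : ∀ x y : Fin 2 × Bool, Compatible x y → square 0 x y = 0 → square 1 x y = 0 →
      y.1 = x.1 + 1 := by decide
  exact key _ _ (compatible_unroll hL i) h0 h1

theorem even_length_of_squareFree {L : List (Fin 2 × Bool)} (hL : IsCyclicallyReduced L)
    (hne : L ≠ []) (hg : SquareFree (FreeGroup.mk L)) : Even L.length := by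
  rw [← fst_eq_iff_even (fst_unroll_succ hL hne hg), (unroll_periodic L).eq]

theorem exists_isRotated_fst_eq_one {L : List (Fin 2 × Bool)} (hL : IsCyclicallyReduced L)
    (hne : L ≠ []) (hg : SquareFree (FreeGroup.mk L)) :
    ∃ L', L ~r L' ∧ (unroll L' 0).1 = 1 := by
  have key : ∀ c : Fin 2, c = 1 ∨ c + 1 = 1 := by decide
  rcases key (unroll L 0).1 with h | h
  · exact ⟨L, .refl L, h⟩
  · refine ⟨L.rotate 1, ⟨1, rfl⟩, ?_⟩
    rw [unroll_rotate, fst_unroll_succ hL hne hg, h]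

theorem cycTransduce_eq_self {L : List (Fin 2 × Bool)} (hL : IsCyclicallyReduced L)
    (hne : L ≠ []) (h0 : (unroll L 0).1 = 1) (hg : SquareFree (FreeGroup.mk L))
    (hg' : SquareFree (FreeGroup.mk (cycTransduce L))) : cycTransduce L = L := by
  obtain ⟨k, hk⟩ := even_length_of_squareFree hL hne hg
  obtain ⟨l, hl⟩ : ∃ l, cycTransduce L = unroll L 0 :: l := by
    have hpos := List.length_pos_of_ne_nil hne
    rw [cycTransduce, show L.length = 1 + (L.length - 1) by omega, transduce_add,
      transduce_succ]
    have hhead := head?_chunk (unroll L 0) (unroll L 1) h0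
    obtain ⟨l, hl⟩ := List.head?_eq_some_iff.1 hhead
    exact ⟨l ++ _, by rw [hl]; rfl⟩
  have hchain : (cycTransduce L ++ cycTransduce L).IsChain fun s t => s.1 ≠ t.1 :=
    isChain_append_self fun i h => by
      rw [fst_unroll_succ (isCyclicallyReduced_cycTransduce hL) (by simp [hl]) hg'] at h
      exact absurd (left_eq_add.1 h) one_ne_zero
  have hfirst : unroll L (k + k) = unroll L 0 := by rw [← hk, (unroll_periodic L).eq]
  have hinit : (cycTransduce L ++ [unroll L 0]).IsChain fun s t => s.1 ≠ t.1 :=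
    hchain.prefix ⟨l, by rw [List.append_assoc, List.singleton_append, ← hl]⟩
  rw [cycTransduce, hk, ← hfirst] at hinit
  rw [cycTransduce, hk, transduce_eq_map (fst_unroll_succ hL hne hg) h0 k hinit, ← hk,
    map_unroll_range]

theorem isConj_shearB_of_squareFree {g : F2} (hg : SquareFree g) (hg' : SquareFree (shearB g)) :
    IsConj (shearB g) g := by
  have hmk : SquareFree (FreeGroup.mk (cycWord g)) :=
    (squareFree_congr (.of_isConj (isConj_mk_cycWord g))).2 hg
  rcases eq_or_ne (cycWord g) [] with hnil | hne
  · have h1 := isConj_mk_cycWord g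
    rw [hnil, ← one_eq_mk, isConj_one_right] at h1
    rw [h1, map_one]
  obtain ⟨L, hrot, h0⟩ := exists_isRotated_fst_eq_one (isCyclicallyReduced_cycWord g) hne hmk
  obtain ⟨r, rfl⟩ := hrot
  have hL := isCyclicallyReduced_rotate (isCyclicallyReduced_cycWord g) r
  have hLg : IsConj (FreeGroup.mk ((cycWord g).rotate r)) g :=
    (isConj_mk_of_isRotated ⟨r, rfl⟩).symm.trans (isConj_mk_cycWord g)
  have himage := isConj_shearB_mk hL
  have hshear := isConj_map shearB hLg
  rw [cycTransduce_eq_self hL (by simpa using hne) h0 ((squareFree_congr (.of_isConj hLg)).2 hg)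
    ((squareFree_congr (.of_isConj (himage.symm.trans hshear))).2 hg')] at himage
  exact (hshear.symm.trans himage).trans hLg

/-- The function that is `1` at the pairs of letters of different type and equal sign, and `-1` at
the pairs of letters of different type and different sign. -/
def signChange (x y : Fin 2 × Bool) : ℤ := if x.1 = y.1 then 0 else if x.2 = y.2 then 1 else -1

theorem cycSum_signChange {L : List (Fin 2 × Bool)} (hL : IsCyclicallyReduced L) :
    cycSum signChange L = 2 * cycSum turn L := by
  rw [cycSum, cycSum, Finset.mul_sum]
  exact cycSum_eq_of_coboundary (f := signChange) (g := fun x y => 2 * turn x y)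
    (fun x => if x = (1, true) then 0 else if x = (1, false) then 2 else 1) (by decide)
    (compatible_unroll hL)

/-- The letters of a word without squares alternate between the two generators. A map that
exchanges the generators therefore shifts it by an odd number of letters, and a sequence of odd
numbers with an odd period has a nonzero sum over each period. -/
theorem cycSum_signChange_ne_zero {L : List (Fin 2 × Bool)} {f : Fin 2 × Bool → Fin 2 × Bool}
    {r : ℕ} (hne : L ≠ []) (halt : ∀ i, (unroll L (i + 1)).1 = (unroll L i).1 + 1)
    (hf : ∀ x, (f x).1 = x.1 + 1) (hsign : ∀ x y, signChange (f x) (f y) = signChange x y)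
    (hr : L.rotate r = L.map f) : cycSum signChange L ≠ 0 := by
  have hshift (i : ℕ) : unroll L (i + r) = f (unroll L i) := by
    rw [← unroll_rotate, hr, unroll_map hne]
  have hodd : Odd r := by
    rw [← Nat.not_even_iff_odd, ← fst_eq_iff_even halt, ← zero_add r, hshift, hf, add_eq_left]
    exact one_ne_zero
  set s : ℕ → ℤ := fun i => signChange (unroll L i) (unroll L (i + 1)) with hs
  have hperiod_length : Function.Periodic s L.length := fun i => by
    simp only [hs, add_right_comm, unroll_periodic L _]
  have hperiod_shift : Function.Periodic s r := fun i => by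
    simp only [hs, add_right_comm i r 1, hshift, hsign]
  have hodd_sign (i : ℕ) : Odd (s i) := by
    have key : ∀ x y : Fin 2 × Bool, y.1 = x.1 + 1 → Odd (signChange x y) := by decide
    exact key _ _ (halt i)
  intro hzero
  have hsum : (L.length : ℤ) * ∑ i ∈ Finset.range r, s i = r * cycSum signChange L := by
    rw [← sum_range_mul_of_periodic hperiod_shift, mul_comm,
      sum_range_mul_of_periodic hperiod_length, cycSum]
  rw [hzero, mul_zero, mul_eq_zero, Nat.cast_eq_zero, List.length_eq_zero_iff] at hsum
  have hsum_odd := (odd_sum_range_iff hodd_sign r).2 hodd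
  rw [hsum.resolve_left hne] at hsum_odd
  exact absurd hsum_odd (by decide)

theorem ActsOnLetters.not_isConj_apply {π : MulAut F2} {f : Fin 2 × Bool → Fin 2 × Bool}
    (h : ActsOnLetters π f) (hf : ∀ x, (f x).1 = x.1 + 1)
    (hsign : ∀ x y, signChange (f x) (f y) = signChange x y) {g : F2} (hg : SquareFree g)
    (ht : turns g = 0) (h0 : cycNorm g ≠ 0) : ¬ IsConj (π g) g := by
  intro hconj
  have hL := isCyclicallyReduced_cycWord g
  have hne : cycWord g ≠ [] := fun hnil => h0 (by rw [cycNorm, hnil, List.length_nil])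
  obtain ⟨r, hr⟩ := isRotated_of_isConj hL (h.isCyclicallyReduced_map g)
    ((isConj_mk_cycWord g).trans (hconj.symm.trans (h.isConj_apply g)))
  refine cycSum_signChange_ne_zero hne (fst_unroll_succ hL hne ?_) hf hsign hr ?_
  · exact (squareFree_congr (.of_isConj (isConj_mk_cycWord g))).2 hg
  · rw [cycSum_signChange hL, ← turns, ht, mul_zero]

theorem not_isConj_swap {g : F2} (hg : SquareFree g) (ht : turns g = 0) (h0 : cycNorm g ≠ 0) :
    ¬ IsConj (swap g) g :=
  actsOnLetters_swap.not_isConj_apply (by decide) (by decide) hg ht h0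

theorem not_isConj_negate_mul_swap {g : F2} (hg : SquareFree g) (ht : turns g = 0)
    (h0 : cycNorm g ≠ 0) : ¬ IsConj ((negate * swap) g) g :=
  ((((actsOnLetters_swap.mul actsOnLetters_flip).mul actsOnLetters_swap).mul
    actsOnLetters_flip).mul actsOnLetters_swap).not_isConj_apply (by decide) (by decide) hg ht h0

/-! ### Balanced words -/

theorem isConj_inv_apply {φ : MulAut F2} {x : F2} (h : IsConj (φ x) x) : IsConj (φ⁻¹ x) x := by
  simpa only [MulAut.inv_apply_self] using (isConj_map φ⁻¹ h).symm

theorem isConj_inv_apply_of_out_mul {ρ φ χ : MulAut F2} (h : out (ρ * φ) = out (χ * ρ))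
    {x y : F2} (hx : IsConj x (ρ (φ y))) : IsConj (χ⁻¹ x) (ρ y) := by
  simpa only [MulAut.mul_apply, MulAut.inv_apply_self] using
    isConj_map χ⁻¹ (hx.trans (isConj_of_out_eq h y))

/-- An element without squares in its cyclic word whose cyclic length is preserved by all one-letter
automorphisms: the situation of an alternating minimal word. -/
structure IsBalanced (g : F2) : Prop where
  squareFree : SquareFree g
  turns_eq : turns g = 0

namespace IsBalanced

variable {w : F2}

theorem cycNorm_move (hw : IsBalanced w) (i : Fin 4) : cycNorm (move i w) = cycNorm w := by
  obtain ⟨⟨h0, h1⟩, ht⟩ := hw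
  have hB := cycNorm_shearB w
  have hA := cycNorm_shearA w
  have hB' := cycNorm_shearB_inv w
  have hA' := cycNorm_shearA_inv w
  fin_cases i
  · change cycNorm (shearB w) = _; omega
  · change cycNorm (shearA w) = _; omega
  · change cycNorm (shearB⁻¹ w) = _; omega
  · change cycNorm (shearA⁻¹ w) = _; omega

theorem swap (hw : IsBalanced w) : IsBalanced (swap w) :=
  ⟨(squareFree_congr (jEquiv_swap w)).1 hw.squareFree, by rw [turns_swap, hw.turns_eq]⟩

theorem flip (hw : IsBalanced w) : IsBalanced (flip w) :=
  ⟨(squareFree_congr (jEquiv_flip w)).1 hw.squareFree, by rw [turns_flip, hw.turns_eq, neg_zero]⟩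

theorem lt_cycNorm_shearB (hw : IsBalanced w) (h : ¬ SquareFree (shearB w)) :
    cycNorm w < cycNorm (shearB (shearB w)) ∧ cycNorm w < cycNorm (shearA (shearB w)) := by
  obtain ⟨⟨h0, h1⟩, ht⟩ := hw
  have hturns := turns_shearB w
  have hsquares := squares_zero_shearB w
  have hnonneg := squares_nonneg 0 (shearB w)
  have hB := cycNorm_shearB (shearB w)
  have hA := cycNorm_shearA (shearB w)
  have hw := cycNorm_shearB w
  unfold SquareFree at h
  omega

theorem lt_cycNorm_shearA (hw : IsBalanced w) (h : ¬ SquareFree (shearA w)) :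
    cycNorm w < cycNorm (shearB (shearA w)) ∧ cycNorm w < cycNorm (shearA (shearA w)) := by
  obtain ⟨⟨h0, h1⟩, ht⟩ := hw
  have hturns := turns_shearA w
  have hsquares := squares_one_shearA w
  have hnonneg := squares_nonneg 0 (shearA w)
  have hB := cycNorm_shearB (shearA w)
  have hA := cycNorm_shearA (shearA w)
  have hw := cycNorm_shearA w
  unfold SquareFree at h
  omega

theorem lt_cycNorm_shearB_inv (hw : IsBalanced w) (h : ¬ SquareFree (shearB⁻¹ w)) :
    cycNorm w < cycNorm (shearB⁻¹ (shearB⁻¹ w)) ∧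
      cycNorm w < cycNorm (shearA⁻¹ (shearB⁻¹ w)) := by
  obtain ⟨⟨h0, h1⟩, ht⟩ := hw
  have hturns := turns_shearB_inv w
  have hsquares := squares_zero_shearB_inv w
  have hnonneg := squares_nonneg 0 (shearB⁻¹ w)
  have hB := cycNorm_shearB_inv (shearB⁻¹ w)
  have hA := cycNorm_shearA_inv (shearB⁻¹ w)
  have hw := cycNorm_shearB_inv w
  unfold SquareFree at h
  omega

theorem lt_cycNorm_shearA_inv (hw : IsBalanced w) (h : ¬ SquareFree (shearA⁻¹ w)) :
    cycNorm w < cycNorm (shearB⁻¹ (shearA⁻¹ w)) ∧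
      cycNorm w < cycNorm (shearA⁻¹ (shearA⁻¹ w)) := by
  obtain ⟨⟨h0, h1⟩, ht⟩ := hw
  have hturns := turns_shearA_inv w
  have hsquares := squares_one_shearA_inv w
  have hnonneg := squares_nonneg 0 (shearA⁻¹ w)
  have hB := cycNorm_shearB_inv (shearA⁻¹ w)
  have hA := cycNorm_shearA_inv (shearA⁻¹ w)
  have hw := cycNorm_shearA_inv w
  unfold SquareFree at h
  omega

end IsBalanced

theorem SquareFree.shearB_inv {w : F2} (hw : SquareFree w) (h : SquareFree (shearB w)) :
    SquareFree (shearB⁻¹ w) :=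
  (squareFree_congr (.of_isConj (isConj_inv_apply (isConj_shearB_of_squareFree hw h)))).2 hw

theorem squareFree_shearB_inv_iff {w : F2} (hw : SquareFree w) :
    SquareFree (shearB⁻¹ w) ↔ SquareFree (shearB w) := by
  refine ⟨fun h => ?_, hw.shearB_inv⟩
  rw [← squareFree_congr (jEquiv_shearB_inv_flip w)]
  rw [← squareFree_congr (jEquiv_shearB_flip w)] at h
  exact ((squareFree_congr (jEquiv_flip w)).1 hw).shearB_inv h

theorem squareFree_shearA_inv_iff {w : F2} (hw : SquareFree w) :
    SquareFree (shearA⁻¹ w) ↔ SquareFree (shearA w) := by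
  rw [← squareFree_congr (jEquiv_shearB_inv_swap w), ← squareFree_congr (jEquiv_shearB_swap w),
    squareFree_shearB_inv_iff ((squareFree_congr (jEquiv_swap w)).1 hw)]

theorem eq_one_or_eq_negate_or_out_mul {ρ : MulAut F2} (h : ρ ∈ signs) :
    (ρ = 1 ∨ ρ = negate) ∨
      out (ρ * shearB) = out (shearB⁻¹ * ρ) ∧ out (ρ * shearA) = out (shearA⁻¹ * ρ) := by
  have hneg {φ : MulAut F2} (hflip : out (flip * φ) = out (φ⁻¹ * flip))
      (hnegate : out (negate * φ) = out (φ * negate)) :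
      out (negate * flip * φ) = out (φ⁻¹ * (negate * flip)) := by
    have hcomm : Commute (out negate) (out φ) := by
      simpa only [Commute, SemiconjBy, map_mul] using hnegate
    simp only [map_mul, map_inv] at hflip ⊢
    rw [mul_assoc, hflip, ← mul_assoc, hcomm.inv_right.eq, mul_assoc]
  rcases h with rfl | rfl | rfl | rfl
  · exact .inl (.inl rfl)
  · exact .inl (.inr rfl)
  · exact .inr ⟨out_flip_mul_shearB, out_flip_mul_shearA⟩
  · exact .inr ⟨hneg out_flip_mul_shearB out_negate_mul_shearB,
      hneg out_flip_mul_shearA out_negate_mul_shearA⟩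

theorem out_mul_comm_of_eq_one_or_negate {ρ : MulAut F2} (h : ρ = 1 ∨ ρ = negate) :
    out (ρ * shearB) = out (shearB * ρ) ∧ out (ρ * shearA) = out (shearA * ρ) := by
  rcases h with rfl | rfl
  · simp
  · exact ⟨out_negate_mul_shearB, out_negate_mul_shearA⟩

namespace IsBalanced

variable {w : F2}

theorem not_isConj_sign_apply (hw : IsBalanced w) (hB : ¬ SquareFree (shearB w))
    (hA : ¬ SquareFree (shearA w)) {ρ : MulAut F2} (hρ : ρ ∈ signs) :
    ¬ IsConj (shearB w) (ρ (shearA w)) := by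
  intro hconj
  have hJ := (isPermutation_of_mem_signs hρ).mem_J
  rcases eq_one_or_eq_negate_or_out_mul hρ with hcomm | ⟨-, hanti⟩
  · have h := isConj_inv_apply_of_out_mul (out_mul_comm_of_eq_one_or_negate hcomm).2 hconj
    have hequiv : JEquiv (shearA w) w := (jEquiv_shearA_inv_shearB w).symm.trans
      ((JEquiv.of_isConj h).trans (jEquiv_apply hJ w).symm)
    exact hA ((squareFree_congr hequiv).2 hw.squareFree)
  · have h := isConj_inv_apply_of_out_mul hanti hconj
    have hlt := (hw.lt_cycNorm_shearB hB).2
    rw [inv_inv] at h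
    rw [cycNorm_congr h, ← cycNorm_congr_J (jEquiv_apply hJ w)] at hlt
    exact lt_irrefl _ hlt

theorem not_isConj_sign_mul_swap_apply (hw : IsBalanced w) (h0 : cycNorm w ≠ 0)
    (hB : ¬ SquareFree (shearB w)) {ρ : MulAut F2} (hρ : ρ ∈ signs) :
    ¬ IsConj (shearB w) ((ρ * F2.swap) (shearA w)) := by
  have hswap : (ρ * F2.swap) (shearA w) = ρ (shearB (F2.swap w)) :=
    congrArg (fun φ : MulAut F2 => ρ (φ w)) swap_mul_shearA
  rw [hswap]
  intro hconj
  have hJ := (isPermutation_of_mem_signs hρ).mem_J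
  rcases eq_one_or_eq_negate_or_out_mul hρ with hcomm | ⟨hanti, -⟩
  · have h := isConj_inv_apply_of_out_mul (out_mul_comm_of_eq_one_or_negate hcomm).1 hconj
    rw [MulAut.inv_apply_self] at h
    rcases hcomm with rfl | rfl
    · exact not_isConj_swap hw.squareFree hw.turns_eq h0 h.symm
    · exact not_isConj_negate_mul_swap hw.squareFree hw.turns_eq h0 h.symm
  · have h := isConj_inv_apply_of_out_mul hanti hconj
    have hlt := (hw.lt_cycNorm_shearB hB).1
    rw [inv_inv] at h
    rw [cycNorm_congr h, ← cycNorm_congr_J (jEquiv_apply hJ _), cycNorm_swap] at hlt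
    exact lt_irrefl _ hlt

theorem not_jEquiv_shearA_shearB (hw : IsBalanced w) (h0 : cycNorm w ≠ 0)
    (hB : ¬ SquareFree (shearB w)) (hA : ¬ SquareFree (shearA w)) :
    ¬ JEquiv (shearA w) (shearB w) := by
  rintro ⟨j, hj, happly⟩
  obtain ⟨π, hπ, hout⟩ := exists_permutation_of_mem_J hj
  have hconj : IsConj (shearB w) (π (shearA w)) := by
    rw [← happly]
    exact isConj_of_out_eq hout _
  obtain ⟨ρ, hρ, rfl | rfl⟩ := hπ.exists_sign
  · exact hw.not_isConj_sign_apply hB hA hρ hconj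
  · exact hw.not_isConj_sign_mul_swap_apply h0 hB hρ hconj

end IsBalanced

/-! ### The graphs of the root classes -/

theorem IsLevelTable.of_forall {n m : ℕ} {u : Fin n → F2} {tgt : Fin n → Fin 4 → Option (Fin n)}
    (hm : ∀ i, cycNorm (u i) = m)
    (h : ∀ i k, (tgt i k).elim (m < cycNorm (move k (u i))) fun t => JEquiv (move k (u i)) (u t)) :
    IsLevelTable u tgt m where
  cycNorm_eq := hm
  equiv_of_some i k t ht := by simpa only [ht, Option.elim_some] using h i k
  lt_of_none i k hk := by simpa only [hk, Option.elim_none] using h i k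

theorem eq_of_jEquiv {n : ℕ} [NeZero n] {u : Fin n → F2} (halt : ∀ i, SquareFree (u i) ↔ i = 0)
    (h : ∀ i j, i ≠ 0 → i < j → ¬ JEquiv (u i) (u j)) (i j : Fin n) (hij : JEquiv (u i) (u j)) :
    i = j := by
  have hzero := squareFree_congr hij
  rw [halt, halt] at hzero
  by_cases hi : i = 0
  · rw [hi, hzero.1 hi]
  · rcases lt_trichotomy i j with hlt | heq | hgt
    · exact absurd hij (h i j hi hlt)
    · exact heq
    · exact absurd hij.symm (h j i (fun hj => hi (hzero.2 hj)) hgt)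

theorem squareFree_of_cycNorm_eq_zero {g : F2} (h : cycNorm g = 0) : SquareFree g := by
  have hnil : cycWord g = [] := List.length_eq_zero_iff.1 h
  simp [SquareFree, squares, hnil, cycSum]

theorem isConj_shearA_of_squareFree {g : F2} (hg : SquareFree g) (hg' : SquareFree (shearA g)) :
    IsConj (shearA g) g := by
  have hconj := isConj_shearB_of_squareFree ((squareFree_congr (jEquiv_swap g)).1 hg)
    ((squareFree_congr (jEquiv_shearB_swap g)).2 hg')
  have hswap : swap (swap g) = g := by rw [← MulAut.mul_apply, swap_mul_swap, MulAut.one_apply]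
  simpa only [shearA, MulAut.mul_apply, hswap] using isConj_map swap hconj

namespace IsBalanced

variable {w : F2} {W : Set F2}

theorem hasPointedGraph_graphR4 (hw : IsBalanced w) (hW : IsAutClass W) (hwW : w ∈ W)
    (hm : cycNorm w ≠ 1) (hB : SquareFree (shearB w)) (hA : SquareFree (shearA w)) :
    HasPointedGraph W graphR4 := by
  have hconjB := isConj_shearB_of_squareFree hw.squareFree hB
  have hconjA := isConj_shearA_of_squareFree hw.squareFree hA
  have htable : IsLevelTable ![w] ![![some 0, some 0, some 0, some 0]] (cycNorm w) := by
    refine .of_forall (fun i => by fin_cases i; rfl) fun i k => ?_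
    fin_cases i
    fin_cases k
    · exact .of_isConj hconjB
    · exact .of_isConj hconjA
    · exact .of_isConj (isConj_inv_apply hconjB)
    · exact .of_isConj (isConj_inv_apply hconjA)
  refine htable.hasPointedGraph hW (fun i => by fin_cases i; exact hwW)
    (fun i j _ => Subsingleton.elim i j) hm (fun i => ?_)
    fun i j => by fin_cases i; fin_cases j; rfl
  fin_cases i
  exact iff_of_true hw.squareFree rfl

theorem isLevelTable_of_squareFree_shearB (hw : IsBalanced w) (hB : SquareFree (shearB w))
    (hA : ¬ SquareFree (shearA w)) :
    IsLevelTable ![w, shearA w]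
      ![![some 0, some 1, some 0, some 1], ![none, none, some 0, some 0]] (cycNorm w) := by
  have hconj := isConj_shearB_of_squareFree hw.squareFree hB
  obtain ⟨hlt, hlt'⟩ := hw.lt_cycNorm_shearA hA
  refine .of_forall (fun i => ?_) fun i k => ?_
  · fin_cases i
    · rfl
    · exact hw.cycNorm_move 1
  · fin_cases i <;> fin_cases k
    · exact .of_isConj hconj
    · exact .refl _
    · exact .of_isConj (isConj_inv_apply hconj)
    · exact (JEquiv.of_isConj (isConj_map shearA⁻¹ hconj)).symm.trans (jEquiv_shearA_inv_shearB w)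
    · exact hlt
    · exact hlt'
    · exact (jEquiv_shearB_inv_shearA w).trans (.of_isConj hconj)
    · exact (MulAut.inv_apply_self _ shearA w).symm ▸ .refl w

theorem hasPointedGraph_graphR5 (hw : IsBalanced w) (hW : IsAutClass W) (hwW : w ∈ W)
    (hm : cycNorm w ≠ 1) (hB : SquareFree (shearB w)) (hA : ¬ SquareFree (shearA w)) :
    HasPointedGraph W graphR5 := by
  have halt (i : Fin 2) : SquareFree (![w, shearA w] i) ↔ i = 0 := by
    fin_cases i
    · exact iff_of_true hw.squareFree rfl
    · exact iff_of_false hA (by decide)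
  refine (hw.isLevelTable_of_squareFree_shearB hB hA).hasPointedGraph hW (fun i => ?_)
    (eq_of_jEquiv halt fun i j hi hij => absurd hij (by decide +revert)) hm halt
    fun i j => by fin_cases i <;> fin_cases j <;> rfl
  fin_cases i
  · exact hwW
  · exact apply_mem_of_isAutClass hW hwW shearA

theorem not_jEquiv_shearB_shearA (hw : IsBalanced w) (hB : ¬ SquareFree (shearB w))
    (hA : ¬ SquareFree (shearA w)) : ¬ JEquiv (shearB w) (shearA w) := fun h =>
  hw.not_jEquiv_shearA_shearB
    (fun h0 => hB (squareFree_of_cycNorm_eq_zero ((hw.cycNorm_move 0).trans h0))) hB hA h.symm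

theorem not_jEquiv_shearB_inv_shearA_inv (hw : IsBalanced w) (hB : ¬ SquareFree (shearB w))
    (hA : ¬ SquareFree (shearA w)) : ¬ JEquiv (shearB⁻¹ w) (shearA⁻¹ w) := fun h =>
  hw.flip.not_jEquiv_shearB_shearA
    (by rwa [squareFree_congr (jEquiv_shearB_flip w), squareFree_shearB_inv_iff hw.squareFree])
    (by rwa [squareFree_congr (jEquiv_shearA_flip w), squareFree_shearA_inv_iff hw.squareFree])
    ((jEquiv_shearB_flip w).trans (h.trans (jEquiv_shearA_flip w).symm))

theorem jEquiv_shearA_inv_of_jEquiv_move (hw : IsBalanced w) (hB : ¬ SquareFree (shearB w)) {x : F2}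
    (hx : ¬ SquareFree x) (hlen : cycNorm x = cycNorm w) {k : Fin 4}
    (h : JEquiv x (move k (shearB⁻¹ w))) : JEquiv x (shearA⁻¹ w) := by
  obtain ⟨hlt, hlt'⟩ :=
    hw.lt_cycNorm_shearB_inv ((squareFree_shearB_inv_iff hw.squareFree).not.2 hB)
  fin_cases k
  · have hxw : JEquiv x (shearB (shearB⁻¹ w)) := h
    rw [MulAut.apply_inv_self] at hxw
    exact absurd ((squareFree_congr hxw).2 hw.squareFree) hx
  · exact h.trans (jEquiv_shearA_shearB_inv w)
  · exact absurd (cycNorm_congr_J h) (hlen.trans_lt hlt).ne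
  · exact absurd (cycNorm_congr_J h) (hlen.trans_lt hlt').ne

theorem jEquiv_shearB_inv_of_jEquiv_move (hw : IsBalanced w) (hA : ¬ SquareFree (shearA w)) {x : F2}
    (hx : ¬ SquareFree x) (hlen : cycNorm x = cycNorm w) {k : Fin 4}
    (h : JEquiv x (move k (shearA⁻¹ w))) : JEquiv x (shearB⁻¹ w) := by
  obtain ⟨hlt, hlt'⟩ :=
    hw.lt_cycNorm_shearA_inv ((squareFree_shearA_inv_iff hw.squareFree).not.2 hA)
  fin_cases k
  · exact h.trans (jEquiv_shearB_shearA_inv w)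
  · have hxw : JEquiv x (shearA (shearA⁻¹ w)) := h
    rw [MulAut.apply_inv_self] at hxw
    exact absurd ((squareFree_congr hxw).2 hw.squareFree) hx
  · exact absurd (cycNorm_congr_J h) (hlen.trans_lt hlt).ne
  · exact absurd (cycNorm_congr_J h) (hlen.trans_lt hlt').ne

end IsBalanced

theorem exists_jEquiv_shearA_move {w y : F2} (h : JEquiv (shearB w) y) :
    ∃ k, JEquiv (shearA w) (move k y) := by
  obtain ⟨k, hk⟩ := h.exists_move 3
  exact ⟨k, (jEquiv_shearA_inv_shearB w).symm.trans hk⟩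

theorem exists_jEquiv_shearB_move {w y : F2} (h : JEquiv (shearA w) y) :
    ∃ k, JEquiv (shearB w) (move k y) := by
  obtain ⟨k, hk⟩ := h.exists_move 2
  exact ⟨k, (jEquiv_shearB_inv_shearA w).symm.trans hk⟩

namespace IsBalanced

variable {w : F2} {W : Set F2}

theorem jEquiv_shearB_shearB_inv_iff (hw : IsBalanced w) (hB : ¬ SquareFree (shearB w))
    (hA : ¬ SquareFree (shearA w)) :
    JEquiv (shearB w) (shearB⁻¹ w) ↔ JEquiv (shearA w) (shearA⁻¹ w) := by
  constructor
  · intro h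
    obtain ⟨k, hk⟩ := exists_jEquiv_shearA_move h
    exact hw.jEquiv_shearA_inv_of_jEquiv_move hB hA (hw.cycNorm_move 1) hk
  · intro h
    obtain ⟨k, hk⟩ := exists_jEquiv_shearB_move h
    exact hw.jEquiv_shearB_inv_of_jEquiv_move hA hB (hw.cycNorm_move 0) hk

theorem jEquiv_shearB_shearA_inv_iff (hw : IsBalanced w) (hB : ¬ SquareFree (shearB w))
    (hA : ¬ SquareFree (shearA w)) :
    JEquiv (shearB w) (shearA⁻¹ w) ↔ JEquiv (shearA w) (shearB⁻¹ w) := by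
  constructor
  · intro h
    obtain ⟨k, hk⟩ := exists_jEquiv_shearA_move h
    exact hw.jEquiv_shearB_inv_of_jEquiv_move hA hA (hw.cycNorm_move 1) hk
  · intro h
    obtain ⟨k, hk⟩ := exists_jEquiv_shearB_move h
    exact hw.jEquiv_shearA_inv_of_jEquiv_move hB hB (hw.cycNorm_move 0) hk

theorem isLevelTable_of_jEquiv (hw : IsBalanced w) (hB : ¬ SquareFree (shearB w))
    (hA : ¬ SquareFree (shearA w)) {s t : Fin 3}
    (hs : JEquiv (shearB⁻¹ w) (![w, shearB w, shearA w] s))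
    (ht : JEquiv (shearA⁻¹ w) (![w, shearB w, shearA w] t)) :
    IsLevelTable ![w, shearB w, shearA w]
      ![![some 1, some 2, some s, some t], ![none, none, some 0, some 2],
        ![none, none, some 1, some 0]] (cycNorm w) := by
  obtain ⟨hltB, hltB'⟩ := hw.lt_cycNorm_shearB hB
  obtain ⟨hltA, hltA'⟩ := hw.lt_cycNorm_shearA hA
  refine .of_forall (fun i => ?_) fun i k => ?_
  · fin_cases i
    · rfl
    · exact hw.cycNorm_move 0
    · exact hw.cycNorm_move 1
  · fin_cases i <;> fin_cases k
    · exact .refl _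
    · exact .refl _
    · exact hs
    · exact ht
    · exact hltB
    · exact hltB'
    · exact (MulAut.inv_apply_self _ shearB w).symm ▸ .refl w
    · exact jEquiv_shearA_inv_shearB w
    · exact hltA
    · exact hltA'
    · exact jEquiv_shearB_inv_shearA w
    · exact (MulAut.inv_apply_self _ shearA w).symm ▸ .refl w

theorem hasPointedGraph_graphR6 (hw : IsBalanced w) (hW : IsAutClass W) (hwW : w ∈ W)
    (hm : cycNorm w ≠ 1) (hB : ¬ SquareFree (shearB w)) (hA : ¬ SquareFree (shearA w))
    (h : JEquiv (shearB w) (shearB⁻¹ w) ∨ JEquiv (shearB w) (shearA⁻¹ w)) :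
    HasPointedGraph W graphR6 := by
  have halt (i : Fin 3) : SquareFree (![w, shearB w, shearA w] i) ↔ i = 0 := by
    fin_cases i
    · exact iff_of_true hw.squareFree rfl
    · exact iff_of_false hB (by decide)
    · exact iff_of_false hA (by decide)
  have hinj := eq_of_jEquiv halt fun i j hi hij => by
    obtain ⟨rfl, rfl⟩ : i = 1 ∧ j = 2 := by omega
    exact hw.not_jEquiv_shearB_shearA hB hA
  have hu (i : Fin 3) : ![w, shearB w, shearA w] i ∈ W := by
    fin_cases i
    · exact hwW
    · exact apply_mem_of_isAutClass hW hwW shearB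
    · exact apply_mem_of_isAutClass hW hwW shearA
  rcases h with h | h
  · have htable := hw.isLevelTable_of_jEquiv hB hA (s := 1) (t := 2) h.symm
      ((hw.jEquiv_shearB_shearB_inv_iff hB hA).1 h).symm
    exact htable.hasPointedGraph hW hu hinj hm halt
      fun i j => by fin_cases i <;> fin_cases j <;> rfl
  · have htable := hw.isLevelTable_of_jEquiv hB hA (s := 2) (t := 1)
      ((hw.jEquiv_shearB_shearA_inv_iff hB hA).1 h).symm h.symm
    exact htable.hasPointedGraph hW hu hinj hm halt
      fun i j => by fin_cases i <;> fin_cases j <;> rfl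

theorem isLevelTable (hw : IsBalanced w) (hB : ¬ SquareFree (shearB w))
    (hA : ¬ SquareFree (shearA w)) :
    IsLevelTable ![w, shearB w, shearA w, shearB⁻¹ w, shearA⁻¹ w]
      ![![some 1, some 2, some 3, some 4], ![none, none, some 0, some 2],
        ![none, none, some 1, some 0], ![some 0, some 4, none, none],
        ![some 3, some 0, none, none]] (cycNorm w) := by
  obtain ⟨hltB, hltB'⟩ := hw.lt_cycNorm_shearB hB
  obtain ⟨hltA, hltA'⟩ := hw.lt_cycNorm_shearA hA
  obtain ⟨hltC, hltC'⟩ :=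
    hw.lt_cycNorm_shearB_inv ((squareFree_shearB_inv_iff hw.squareFree).not.2 hB)
  obtain ⟨hltD, hltD'⟩ :=
    hw.lt_cycNorm_shearA_inv ((squareFree_shearA_inv_iff hw.squareFree).not.2 hA)
  refine .of_forall (fun i => ?_) fun i k => ?_
  · fin_cases i
    exacts [rfl, hw.cycNorm_move 0, hw.cycNorm_move 1, hw.cycNorm_move 2, hw.cycNorm_move 3]
  · fin_cases i
    · fin_cases k <;> exact .refl _
    · fin_cases k
      exacts [hltB, hltB', (MulAut.inv_apply_self _ shearB w).symm ▸ .refl w,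
        jEquiv_shearA_inv_shearB w]
    · fin_cases k
      exacts [hltA, hltA', jEquiv_shearB_inv_shearA w,
        (MulAut.inv_apply_self _ shearA w).symm ▸ .refl w]
    · fin_cases k
      exacts [(MulAut.apply_inv_self _ shearB w).symm ▸ .refl w, jEquiv_shearA_shearB_inv w,
        hltC, hltC']
    · fin_cases k
      exacts [jEquiv_shearB_shearA_inv w, (MulAut.apply_inv_self _ shearA w).symm ▸ .refl w,
        hltD, hltD']

theorem hasPointedGraph_graphR7 (hw : IsBalanced w) (hW : IsAutClass W) (hwW : w ∈ W)
    (hm : cycNorm w ≠ 1) (hB : ¬ SquareFree (shearB w)) (hA : ¬ SquareFree (shearA w))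
    (hBB : ¬ JEquiv (shearB w) (shearB⁻¹ w)) (hBA : ¬ JEquiv (shearB w) (shearA⁻¹ w)) :
    HasPointedGraph W graphR7 := by
  have halt (i : Fin 5) :
      SquareFree (![w, shearB w, shearA w, shearB⁻¹ w, shearA⁻¹ w] i) ↔ i = 0 := by
    fin_cases i
    · exact iff_of_true hw.squareFree rfl
    · exact iff_of_false hB (by decide)
    · exact iff_of_false hA (by decide)
    · exact iff_of_false ((squareFree_shearB_inv_iff hw.squareFree).not.2 hB) (by decide)
    · exact iff_of_false ((squareFree_shearA_inv_iff hw.squareFree).not.2 hA) (by decide)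
  have hinj := eq_of_jEquiv halt fun i j hi hij => by
    have hcases : (i = 1 ∧ j = 2) ∨ (i = 1 ∧ j = 3) ∨ (i = 1 ∧ j = 4) ∨ (i = 2 ∧ j = 3) ∨
      (i = 2 ∧ j = 4) ∨ (i = 3 ∧ j = 4) := by omega
    rcases hcases with
      ⟨rfl, rfl⟩ | ⟨rfl, rfl⟩ | ⟨rfl, rfl⟩ | ⟨rfl, rfl⟩ | ⟨rfl, rfl⟩ | ⟨rfl, rfl⟩
    · exact hw.not_jEquiv_shearB_shearA hB hA
    · exact hBB
    · exact hBA
    · exact (hw.jEquiv_shearB_shearA_inv_iff hB hA).not.1 hBA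
    · exact (hw.jEquiv_shearB_shearB_inv_iff hB hA).not.1 hBB
    · exact hw.not_jEquiv_shearB_inv_shearA_inv hB hA
  refine (hw.isLevelTable hB hA).hasPointedGraph hW (Fin.cases hwW fun k => ?_) hinj hm halt
    fun i j => by fin_cases i <;> fin_cases j <;> rfl
  fin_cases k <;> exact apply_mem_of_isAutClass hW hwW _

theorem hasPointedGraph (hw : IsBalanced w) (hW : IsAutClass W) (hwW : w ∈ W)
    (hm : cycNorm w ≠ 1) :
    HasPointedGraph W graphR4 ∨ HasPointedGraph W graphR5 ∨ HasPointedGraph W graphR6 ∨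
      HasPointedGraph W graphR7 := by
  by_cases hB : SquareFree (shearB w) <;> by_cases hA : SquareFree (shearA w)
  · exact .inl (hw.hasPointedGraph_graphR4 hW hwW hm hB hA)
  · exact .inr (.inl (hw.hasPointedGraph_graphR5 hW hwW hm hB hA))
  · exact .inr (.inl (hw.swap.hasPointedGraph_graphR5 hW
      (apply_mem_of_isAutClass hW hwW F2.swap) (by rwa [cycNorm_swap])
      ((squareFree_congr (jEquiv_shearB_swap w)).2 hA)
      ((squareFree_congr (jEquiv_shearA_swap w)).not.2 hB)))
  · by_cases h : JEquiv (shearB w) (shearB⁻¹ w) ∨ JEquiv (shearB w) (shearA⁻¹ w)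
    · exact .inr (.inr (.inl (hw.hasPointedGraph_graphR6 hW hwW hm hB hA h)))
    · obtain ⟨hBB, hBA⟩ := not_or.1 h
      exact .inr (.inr (.inr (hw.hasPointedGraph_graphR7 hW hwW hm hB hA hBB hBA)))

theorem card_vertex (hw : IsBalanced w) (hW : IsAutClass W) (hwW : w ∈ W)
    (hm : cycNorm w ≠ 1) : Nat.card (Vertex W) ∈ ({1, 2, 3, 5} : Set ℕ) := by
  obtain h | h | h | h := hw.hasPointedGraph hW hwW hm <;> rw [h.card_vertex] <;> simp

end IsBalanced

theorem IsMinimal.isLocallyMinimal {w : F2} (h : IsMinimal w) : IsLocallyMinimal w := by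
  intro i
  obtain ⟨g, hg⟩ := isConj_iff.1 (isConj_mk_cycWord (move i w)).symm
  have hle := h (MulAut.conj g * move i)
  rw [MulAut.mul_apply, MulAut.conj_apply, hg, norm_mk_cycWord] at hle
  exact (cycNorm_le_norm w).trans hle

theorem IsMinimal.isBalanced {w : F2} (h : IsMinimal w) (h1 : w.norm ≠ 1) (ha : IsAlternating w) :
    IsBalanced w := by
  have hsq := (isAlternating_iff h.isCyclic h1).1 ha
  refine ⟨hsq, ?_⟩
  have hle := h.isLocallyMinimal 0
  have hle' := h.isLocallyMinimal 2
  have hlen := cycNorm_shearB w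
  have hlen' := cycNorm_shearB_inv w
  have hbb := hsq.2
  rw [move_zero] at hle
  rw [move_two] at hle'
  omega

theorem cycNorm_ne_one {W : Set F2} (hW : IsAutClass W) (h1 : ∀ w ∈ W, FreeGroup.norm w ≠ 1)
    {w : F2} (hw : w ∈ W) : cycNorm w ≠ 1 := by
  rw [← norm_mk_cycWord]
  exact h1 _ (mk_cycWord_mem hW hw)

theorem isMinimal_of_norm_eq_one {v : F2} (h : v.norm = 1) : IsMinimal v := by
  intro φ
  rw [h, Nat.one_le_iff_ne_zero, Ne, FreeGroup.norm_eq_zero, MulEquiv.map_eq_one_iff,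
    ← FreeGroup.norm_eq_zero, h]
  exact one_ne_zero

theorem jEquiv_a_of_mem_letters {x : F2} (hx : x ∈ letters) : JEquiv a x := by
  rcases hx with rfl | rfl | rfl | rfl
  · exact .refl _
  · exact ⟨swap, swap_mem_J, by simp⟩
  · exact ⟨negate, isPermutation_negate.mem_J, by simp⟩
  · exact ⟨negate * swap, J.mul_mem isPermutation_negate.mem_J swap_mem_J, by simp⟩

theorem card_vertex_of_norm_eq_one {W : Set F2} (hW : IsAutClass W) {v : F2} (hv : v ∈ W)
    (h : v.norm = 1) : Nat.card (Vertex W) = 1 := by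
  have hmin := isMinimal_of_norm_eq_one h
  have hletter (w : MinimalWord W) : w.1 ∈ letters := by
    obtain ⟨φ, hφ⟩ := exists_aut_of_mem hW w.2.1 hv
    obtain ⟨ψ, hψ⟩ := exists_aut_of_mem hW hv w.2.1
    have hle := w.2.2 φ
    have hge := hmin ψ
    rw [hφ] at hle
    rw [hψ] at hge
    exact mem_letters_iff_norm_eq_one.2 (by omega)
  rw [Nat.card_eq_one_iff_unique]
  refine ⟨⟨?_⟩, ⟨Quotient.mk (jSetoid W) ⟨v, hv, hmin⟩⟩⟩
  rintro ⟨x⟩ ⟨y⟩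
  exact Quotient.sound (s := jSetoid W)
    ((jEquiv_a_of_mem_letters (hletter x)).symm.trans (jEquiv_a_of_mem_letters (hletter y)))

theorem isBalanced_shearB_inv {w : F2} (h0 : squares 0 w = turns w) (h1 : squares 1 w = turns w)
    (h : squares 1 (shearB⁻¹ w) = 0) : IsBalanced (shearB⁻¹ w) := by
  have hturns := turns_shearB_inv w
  have hsq := squares_zero_shearB_inv w
  exact ⟨⟨by omega, h⟩, by omega⟩

theorem isBalanced_shearA_inv {w : F2} (h0 : squares 0 w = turns w) (h1 : squares 1 w = turns w)
    (h : squares 0 (shearA⁻¹ w) = 0) : IsBalanced (shearA⁻¹ w) := by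
  have hturns := turns_shearA_inv w
  have hsq := squares_one_shearA_inv w
  exact ⟨⟨h, by omega⟩, by omega⟩

theorem isLevelTable_of_turns_pos {w : F2} (h0 : squares 0 w = turns w)
    (h1 : squares 1 w = turns w) (ht : 0 < turns w) (hB : squares 1 (shearB⁻¹ w) ≠ 0)
    (hA : squares 0 (shearA⁻¹ w) ≠ 0) :
    IsLevelTable ![w, shearB⁻¹ w, shearA⁻¹ w]
      ![![none, none, some 1, some 2], ![some 0, some 2, none, none],
        ![some 1, some 0, none, none]] (cycNorm w) := by
  have hB' := (squares_nonneg 1 (shearB⁻¹ w)).lt_of_ne' hB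
  have hA' := (squares_nonneg 0 (shearA⁻¹ w)).lt_of_ne' hA
  have hturnsB := turns_shearB_inv w
  have hturnsA := turns_shearA_inv w
  have hsqB := squares_zero_shearB_inv w
  have hsqA := squares_one_shearA_inv w
  have hlenB := cycNorm_shearB w
  have hlenA := cycNorm_shearA w
  have hlenB' := cycNorm_shearB_inv w
  have hlenA' := cycNorm_shearA_inv w
  have hlenBB := cycNorm_shearB_inv (shearB⁻¹ w)
  have hlenAB := cycNorm_shearA_inv (shearB⁻¹ w)
  have hlenBA := cycNorm_shearB_inv (shearA⁻¹ w)
  have hlenAA := cycNorm_shearA_inv (shearA⁻¹ w)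
  refine .of_forall (fun i => ?_) fun i k => ?_
  · fin_cases i
    exacts [rfl, (by omega : cycNorm (shearB⁻¹ w) = cycNorm w),
      (by omega : cycNorm (shearA⁻¹ w) = cycNorm w)]
  · fin_cases i
    · fin_cases k
      exacts [(by omega : cycNorm w < cycNorm (shearB w)),
        (by omega : cycNorm w < cycNorm (shearA w)), .refl _, .refl _]
    · fin_cases k
      exacts [(MulAut.apply_inv_self _ shearB w).symm ▸ .refl w, jEquiv_shearA_shearB_inv w,
        (by omega : cycNorm w < cycNorm (shearB⁻¹ (shearB⁻¹ w))),
        (by omega : cycNorm w < cycNorm (shearA⁻¹ (shearB⁻¹ w)))]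
    · fin_cases k
      exacts [jEquiv_shearB_shearA_inv w, (MulAut.apply_inv_self _ shearA w).symm ▸ .refl w,
        (by omega : cycNorm w < cycNorm (shearB⁻¹ (shearA⁻¹ w))),
        (by omega : cycNorm w < cycNorm (shearA⁻¹ (shearA⁻¹ w)))]

theorem card_vertex_of_turns_pos {W : Set F2} (hW : IsAutClass W) {w : F2} (hwW : w ∈ W)
    (hm : cycNorm w ≠ 1) (h0 : squares 0 w = turns w) (h1 : squares 1 w = turns w)
    (ht : 0 < turns w) : Nat.card (Vertex W) ∈ ({1, 2, 3, 5} : Set ℕ) := by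
  have hB := apply_mem_of_isAutClass hW hwW shearB⁻¹
  have hA := apply_mem_of_isAutClass hW hwW shearA⁻¹
  have hlenB := cycNorm_shearB_inv w
  have hlenA := cycNorm_shearA_inv w
  by_cases hbb : squares 1 (shearB⁻¹ w) = 0
  · exact (isBalanced_shearB_inv h0 h1 hbb).card_vertex hW hB (by omega)
  by_cases haa : squares 0 (shearA⁻¹ w) = 0
  · exact (isBalanced_shearA_inv h0 h1 haa).card_vertex hW hA (by omega)
  have htable := isLevelTable_of_turns_pos h0 h1 ht hbb haa
  obtain ⟨hne, hle⟩ := htable.card_vertex hW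
    (Fin.cases hwW fun i => by fin_cases i; exacts [hB, hA]) three_ne_zero
  simp only [Set.mem_insert_iff, Set.mem_singleton_iff]
  omega

theorem card_vertex_of_isRootClass {W : Set F2} (hW : IsRootClass W) :
    Nat.card (Vertex W) ∈ ({1, 2, 3, 5} : Set ℕ) := by
  obtain ⟨hA, w, hw, hc, habs, heq⟩ := hW
  by_cases hone : ∃ v ∈ W, FreeGroup.norm v = 1
  · obtain ⟨v, hv, h⟩ := hone
    exact .inl (card_vertex_of_norm_eq_one hA hv h)
  push Not at hone
  have hn := hone w hw
  have hm := cycNorm_ne_one hA hone hw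
  rw [subwordCount_ab_sub hc hn, subwordCount_aa hc hn] at habs
  have hsq : squares 0 w = squares 1 w := by
    rw [← subwordCount_aa hc hn, ← subwordCount_bb hc hn, heq]
  rcases lt_trichotomy (turns w) 0 with ht | ht | ht
  · rw [abs_of_neg ht] at habs
    refine card_vertex_of_turns_pos hA (apply_mem_of_isAutClass hA hw flip)
      (by rwa [cycNorm_flip]) ?_ ?_ ?_
    all_goals
      simp only [squares_flip, turns_flip]
      omega
  · rw [ht, abs_zero] at habs
    exact IsBalanced.card_vertex ⟨⟨habs.symm, by omega⟩, ht⟩ hA hw hm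
  · rw [abs_of_pos ht] at habs
    exact card_vertex_of_turns_pos hA hw hm habs.symm (by omega) ht

end F2

/-- The hypothesis on lengths excludes only the class of `a`, the automorphic conjugacy class whose
minimal words have length one. -/
theorem theorem4 :
    (∀ W : Set F2, F2.IsRootClass W →
      (∃ w ∈ W, F2.IsMinimal w ∧ F2.IsAlternating w) →
      (∀ w ∈ W, FreeGroup.norm w ≠ 1) →
      ∃ v₀ : F2.Vertex W,
        (∀ v : F2.Vertex W, v.HasAlternating ↔ v = v₀) ∧
        ((F2.Gamma W).PointedIso v₀ F2.graphR4 0 ∨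
          (F2.Gamma W).PointedIso v₀ F2.graphR5 0 ∨
          (F2.Gamma W).PointedIso v₀ F2.graphR6 0 ∨
          (F2.Gamma W).PointedIso v₀ F2.graphR7 0)) ∧
    (∀ W : Set F2, F2.IsRootClass W →
      Nat.card (F2.Vertex W) ∈ ({1, 2, 3, 5} : Set ℕ)) := by
  refine ⟨?_, fun W hW => F2.card_vertex_of_isRootClass hW⟩
  rintro W ⟨hW, -⟩ ⟨w, hw, hmin, halt⟩ hone
  obtain ⟨v₀, hv₀, h⟩ | ⟨v₀, hv₀, h⟩ | ⟨v₀, hv₀, h⟩ | ⟨v₀, hv₀, h⟩ :=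
    (hmin.isBalanced (hone w hw) halt).hasPointedGraph hW hw (F2.cycNorm_ne_one hW hone hw)
  exacts [⟨v₀, hv₀, .inl h⟩, ⟨v₀, hv₀, .inr (.inl h)⟩, ⟨v₀, hv₀, .inr (.inr (.inl h))⟩,
    ⟨v₀, hv₀, .inr (.inr (.inr h))⟩]
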